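/- Let $p$ be an odd prime and $n\ge 2$. Let $\mathbb{L}_p=W(\overline{\mathbb{F}}_p)((p^{\mathbb{Q}}))$ be the $p$-adic Mal'cev–Neumann field, i.e. the generalized power series $\sum_{x\in\mathbb{Q}}a_xt^x$ with $a_x\in W(\overline{\mathbb F}_p)$ and well-ordered support, modulo the ideal of null series (so that $t=p$). Every $\alpha\in\mathbb{L}_p$ has a unique canonical expansion $\alpha=\sum_{x\in\mathbb{Q}}[\alpha_x]p^x$ with $\alpha_x\in\overline{\mathbb{F}}_p$ and well-ordered support, where $[\cdot]$ is the Teichmüller lift; put $C_x(\alpha)=\alpha_x$ and let $v_p(\alpha)$ be the least element of the support ($\infty$ if $\alpha=0$). For $P=\sum_{i=0}^{N}a_{N-i}T^i\in\mathbb{L}_p[T]$ of degree $N\ge 1$ with $P(0)=a_N\ne 0$, the Newton polygon is the lower boundary of the convex hull of the points $(i,v_p(a_i))$, $0\le i\le N$ (omitting those with $a_i=0$); let $m$ be the abscissa of its last vertex before $N$, let $s=\frac{v_p(a_N)-v_p(a_m)}{N-m}$ be its largest slope, and let $\mathrm{Res}_P(T)=\sum_{k=0}^{N-m}C_0\bigl(a_{N-k}\,p^{-v_p(a_m)-s(N-m-k)}\bigr)T^k\in\overline{\mathbb{F}}_p[T]$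 be the residue polynomial. The (finite stages of the) transfinite Newton algorithm for $f\in\mathbb{L}_p[T]$ start with $r_0=0$; given $r_i$, put $\Phi(T)=f(T+r_i)$; if $\Phi(0)\neq0$, choose a root $c_i\in\overline{\mathbb{F}}_p$ of $\mathrm{Res}_\Phi$ and put $r_{i+1}=r_i+[c_i]p^{s}$ with $s$ the largest slope of $\Phi$; if $\Phi(0)=0$, the algorithm stops, and we put $r_{i+1}=r_i$. Let $\zeta_{2(p-1)}$ be a primitive $2(p-1)$-th root of unity in $\overline{\mathbb{F}}_p$, and denote its Teichmüller lift by the same symbol. Apply the algorithm to the cyclotomic polynomial $\Phi_{p^n}(T)=\sum_{k=0}^{p-1}T^{p^{n-1}k}$, choosing the root $c_1=(-1)^n\zeta_{2(p-1)}$ in the step that produces $r_2$. Such a run of the algorithm exists, and for every such run (whatever the other choices) the $i$-th approximation $\zeta_{p^n}^{(i)}:=r_{i+1}$ is $$\zeta_{p^n}^{(i)}=\begin{cases}\displaystyle\sum_{k=0}^{i}\frac{(-1)^{kn}}{[k!]}\,\zeta_{2(p-1)}^k\,p^{\frac{k}{p^{n-1}(p-1)}}, & 0\le i\le p-1,\\[2mm]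 \displaystyle\zeta_{p^n}^{(p-1)}+\sum_{l=n}^{i-p+n}(-1)^n\zeta_{2(p-1)}\,p^{\frac{1}{p^{n-2}(p-1)}-\frac1{p^l}}, & i\ge p.\end{cases}$$ Moreover, for every primitive $p^n$-th root of unity $\zeta_{p^n}\in\mathbb{L}_p$ with $C_{1/(p^{n-1}(p-1))}(\zeta_{p^n})=(-1)^n\zeta_{2(p-1)}$, the canonical expansion of $\zeta_{p^n}$ at exponents smaller than $\frac{1}{p^{n-2}(p-1)}$ is given by these terms: $C_x(\zeta_{p^n})=\frac{(-1)^{kn}}{k!}\zeta_{2(p-1)}^k$ for $x=\frac{k}{p^{n-1}(p-1)}$ with $0\le k\le p-1$; $C_x(\zeta_{p^n})=(-1)^n\zeta_{2(p-1)}$ for $x=\frac{1}{p^{n-2}(p-1)}-\frac{1}{p^l}$ with $l\ge n$; and $C_x(\zeta_{p^n})=0$ for every other $x<\frac{1}{p^{n-2}(p-1)}$. -/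

import Mathlib

/-- The residue field `𝔽̄_p`. -/
abbrev Fpbar (p : ℕ) [Fact p.Prime] : Type := AlgebraicClosure (ZMod p)

/-- The ring of integers `W(𝔽̄_p)` of the completed maximal unramified extension of `ℚ_p`. -/
abbrev Wbar (p : ℕ) [Fact p.Prime] : Type := WittVector p (Fpbar p)

/-- The ideal of null series in `W(𝔽̄_p)((t^ℚ))`. A series `∑ a_x t^x` is null, i.e.
`∑_{k ∈ ℤ} a_{x+k} p^k = 0` for every `x`, exactly when it is a multiple of `t - p`
(the quotient series is `b_x = ∑_{k ≥ 1} a_{x+k} p^{k-1}`). -/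
noncomputable def nullIdeal (p : ℕ) [Fact p.Prime] : Ideal (HahnSeries ℚ (Wbar p)) :=
  Ideal.span {HahnSeries.single (1 : ℚ) (1 : Wbar p) - HahnSeries.C (p : Wbar p)}

/-- The `p`-adic Mal'cev–Neumann field `𝕃_p = W(𝔽̄_p)((p^ℚ))`: generalized power series in `t`
with exponents in `ℚ`, well-ordered support and coefficients in `W(𝔽̄_p)`, modulo null series,
so that `t = p`. -/
def MalcevNeumann (p : ℕ) [Fact p.Prime] : Type := HahnSeries ℚ (Wbar p) ⧸ nullIdeal p

namespace MalcevNeumann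

variable (p : ℕ) [Fact p.Prime]

noncomputable instance : CommRing (MalcevNeumann p) :=
  inferInstanceAs (CommRing (HahnSeries ℚ (Wbar p) ⧸ nullIdeal p))

/-- The class in `𝕃_p` of a generalized power series. -/
noncomputable def mk : HahnSeries ℚ (Wbar p) →+* MalcevNeumann p :=
  Ideal.Quotient.mk (nullIdeal p)

/-- The Teichmüller representative `[c] ∈ 𝕃_p` of `c ∈ 𝔽̄_p`. -/
noncomputable def teich : Fpbar p →* MalcevNeumann p :=
  ((mk p).comp HahnSeries.C : Wbar p →+* MalcevNeumann p).toMonoidHom.comp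
    (WittVector.teichmuller p)

/-- The element `p^x ∈ 𝕃_p`, for `x ∈ ℚ`. -/
noncomputable def ppow (x : ℚ) : MalcevNeumann p := mk p (HahnSeries.single x 1)

/-- The series `∑ [α_x] t^x`. -/
noncomputable def teichSeries (α : HahnSeries ℚ (Fpbar p)) : HahnSeries ℚ (Wbar p) where
  coeff x := WittVector.teichmuller p (α.coeff x)
  isPWO_support' := α.isPWO_support.mono fun x hx h => hx (by simp [h])

/-- The element `∑ [α_x] p^x` of `𝕃_p`, for a family `α` with well-ordered support. -/
noncomputable def ofCoeffs (α : HahnSeries ℚ (Fpbar p)) : MalcevNeumann p :=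
  mk p (teichSeries p α)

variable {p}

theorem coeff_sub_mul (b : HahnSeries ℚ (Wbar p)) (x : ℚ) :
    ((HahnSeries.single (1 : ℚ) (1 : Wbar p) - HahnSeries.C (p : Wbar p)) * b).coeff x
      = b.coeff (x - 1) - (p : Wbar p) * b.coeff x := by
  rw [sub_mul, HahnSeries.coeff_sub, HahnSeries.coeff_single_mul, one_mul,
    HahnSeries.C_mul_eq_smul, HahnSeries.coeff_smul, smul_eq_mul]

theorem ofCoeffs_injective : Function.Injective (ofCoeffs p) := by
  intro α β h
  have h1 : teichSeries p α - teichSeries p β ∈ nullIdeal p := Ideal.Quotient.eq.1 h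
  obtain ⟨b, hb⟩ := Ideal.mem_span_singleton.1 h1
  have hx : ∀ x, WittVector.teichmuller p (α.coeff x) - WittVector.teichmuller p (β.coeff x)
      = b.coeff (x - 1) - (p : Wbar p) * b.coeff x := by
    intro x
    rw [← coeff_sub_mul, ← hb]
    rfl
  have hp0 : (p : Wbar p) ≠ 0 := WittVector.p_nonzero p (Fpbar p)
  by_contra hne
  have hne' : (α - β) ≠ 0 := sub_ne_zero.2 hne
  have hs := HahnSeries.support_nonempty_iff.2 hne'
  set x₀ := (α - β).isWF_support.min hs with hx₀
  have hx₀mem : α.coeff x₀ ≠ β.coeff x₀ := by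
    have := (α - β).isWF_support.min_mem hs
    rw [← hx₀, HahnSeries.mem_support, HahnSeries.coeff_sub, sub_ne_zero] at this
    exact this
  have hlt : ∀ y < x₀, α.coeff y = β.coeff y := by
    intro y hy
    by_contra hc
    exact (α - β).isWF_support.not_lt_min hs
      (by rw [HahnSeries.mem_support, HahnSeries.coeff_sub, sub_ne_zero]; exact hc) hy
  have hb0 : ∀ y < x₀, b.coeff y = 0 := by
    intro y hy
    by_contra hc
    have hbs : b.support.Nonempty := ⟨y, hc⟩
    have hmem := b.isWF_support.min_mem hbs
    have hle : b.isWF_support.min hbs ≤ y := b.isWF_support.min_le hbs hc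
    have h2 := hx (b.isWF_support.min hbs)
    rw [hlt _ (lt_of_le_of_lt hle hy), sub_self] at h2
    have h3 : b.coeff (b.isWF_support.min hbs - 1) = 0 := by
      by_contra h4
      exact b.isWF_support.not_lt_min hbs h4 (by linarith)
    rw [h3, zero_sub, eq_comm, neg_eq_zero] at h2
    exact hmem ((mul_eq_zero.1 h2).resolve_left hp0)
  have h5 := hx x₀
  rw [hb0 _ (by linarith), zero_sub, sub_eq_iff_eq_add] at h5
  have h6 := congrArg WittVector.constantCoeff h5
  have h7 : WittVector.constantCoeff (p : Wbar p) = 0 := by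
    rw [map_natCast]; exact CharP.cast_eq_zero _ _
  rw [map_add, map_neg, map_mul, h7, zero_mul, neg_zero, zero_add] at h6
  exact hx₀mem h6

theorem exists_carry (w : Wbar p) : ∃ q : Wbar p,
    w = WittVector.teichmuller p (w.coeff 0) + (p : Wbar p) * q := by
  have h : w - WittVector.teichmuller p (w.coeff 0) ∈ Ideal.span {(p : Wbar p)} := by
    rw [← WittVector.ker_constantCoeff, RingHom.mem_ker, map_sub, sub_eq_zero]
    rfl
  obtain ⟨q, hq⟩ := Ideal.mem_span_singleton.1 h
  exact ⟨q, by rw [← hq]; ring⟩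

theorem exists_carried {R : Type*} [AddCommGroup R] (a : HahnSeries ℚ R) (q : R → R)
    (hq0 : q 0 = 0) : ∃ u : ℚ → R, (∀ x, u x = a.coeff x + q (u (x - 1))) ∧
      (Function.support u).IsPWO := by
  classical
  by_cases ha : a = 0
  · exact ⟨fun _ => 0, fun x => by simp [ha, hq0], by simp⟩
  have has := HahnSeries.support_nonempty_iff.2 ha
  obtain ⟨m, ham⟩ : ∃ m, ∀ y < m, a.coeff y = 0 := by
    refine ⟨a.isWF_support.min has, fun y hy => ?_⟩
    by_contra hc
    exact a.isWF_support.not_lt_min has hc hy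
  -- `F N x` is the coefficient at `x` after adding the carries from `x - 1, …, x - N + 1`
  obtain ⟨F, hF0, hFs⟩ : ∃ F : ℕ → ℚ → R, (∀ x, F 0 x = 0) ∧
      ∀ N x, F (N + 1) x = a.coeff x + q (F N (x - 1)) :=
    ⟨fun N => Nat.rec (fun _ => 0) (fun _ f x => a.coeff x + q (f (x - 1))) N,
      fun _ => rfl, fun _ _ => rfl⟩
  have hFm : ∀ N, ∀ y < m, F N y = 0 := by
    intro N
    induction N with
    | zero => intro y _; exact hF0 y
    | succ N ih =>
      intro y hy
      rw [hFs, ham y hy, ih (y - 1) (by linarith), hq0, add_zero]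
  have hFsupp : ∀ N x, F N x ≠ 0 → ∃ k : ℕ, x - k ∈ a.support := by
    intro N
    induction N with
    | zero => intro x hx; exact absurd (hF0 x) hx
    | succ N ih =>
      intro x hx
      rcases eq_or_ne (F N (x - 1)) 0 with h | h
      · refine ⟨0, ?_⟩
        rw [hFs, h, hq0, add_zero] at hx
        simpa using hx
      · obtain ⟨k, hk⟩ := ih _ h
        refine ⟨k + 1, ?_⟩
        have : x - ((k + 1 : ℕ) : ℚ) = x - 1 - k := by push_cast; ring
        rwa [this]
  refine ⟨fun x => F (⌊x - m⌋₊ + 1) x, ?_, ?_⟩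
  · intro x
    simp only
    rw [hFs]
    by_cases h1 : m ≤ x - 1
    · have : ⌊x - m⌋₊ = ⌊x - 1 - m⌋₊ + 1 := by
        rw [← Nat.floor_add_one (by linarith)]
        congr 1
        ring
      rw [this]
    · rw [hFm _ _ (not_le.1 h1), hFm _ _ (not_le.1 h1)]
  · have hN : (Set.range (fun k : ℕ => (k : ℚ))).IsPWO := by
      rw [← Set.image_univ]
      exact (Set.isPWO_of_wellQuasiOrderedLE _).image_of_monotone Nat.mono_cast
    refine (a.isPWO_support.add hN).mono ?_
    intro x hx
    obtain ⟨k, hk⟩ := hFsupp _ _ hx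
    exact ⟨x - k, hk, k, ⟨k, rfl⟩, by simp⟩

theorem ofCoeffs_surjective : Function.Surjective (ofCoeffs p) := by
  intro A
  obtain ⟨a, rfl⟩ := Ideal.Quotient.mk_surjective A
  have hp0 : (p : Wbar p) ≠ 0 := WittVector.p_nonzero p (Fpbar p)
  choose q hq using exists_carry (p := p)
  have hq0 : q 0 = 0 := by
    have h := hq 0
    rw [WittVector.zero_coeff, WittVector.teichmuller_zero, zero_add, eq_comm] at h
    exact (mul_eq_zero.1 h).resolve_left hp0
  obtain ⟨u, hu, hPWO⟩ := exists_carried a q hq0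
  let α : HahnSeries ℚ (Fpbar p) :=
    { coeff := fun x => (u x).coeff 0
      isPWO_support' := hPWO.mono fun x hx h => hx (by simp [h]) }
  let b : HahnSeries ℚ (Wbar p) :=
    { coeff := fun x => q (u x)
      isPWO_support' := hPWO.mono fun x hx h => hx (by simp [h, hq0]) }
  refine ⟨α, ?_⟩
  refine Ideal.Quotient.eq.2 (Ideal.mem_span_singleton.2 ⟨b, ?_⟩)
  ext x : 2
  rw [coeff_sub_mul, HahnSeries.coeff_sub]
  change WittVector.teichmuller p ((u x).coeff 0) - a.coeff x
    = q (u (x - 1)) - (p : Wbar p) * q (u x)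
  have h1 := hq (u x)
  have h2 := hu x
  linear_combination h2 - h1

/-- Canonical expansions: every element of `𝕃_p` can be written in exactly one way as
`∑ [α_x] p^x` with `α_x ∈ 𝔽̄_p` and well-ordered support. -/
noncomputable def expansion : MalcevNeumann p ≃ HahnSeries ℚ (Fpbar p) :=
  (Equiv.ofBijective (ofCoeffs p) ⟨ofCoeffs_injective, ofCoeffs_surjective⟩).symm

/-- The coefficient `C_x(α) ∈ 𝔽̄_p` of `p^x` in the canonical expansion of `α`. -/
noncomputable def coeffAt (x : ℚ) (α : MalcevNeumann p) : Fpbar p := (expansion α).coeff x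

/-- The valuation `v_p(α) ∈ ℚ ∪ {∞}`: the least element of the support of the canonical
expansion, and `∞` for `α = 0`. -/
noncomputable def val (α : MalcevNeumann p) : WithTop ℚ := (expansion α).orderTop

theorem ofCoeffs_zero : ofCoeffs p 0 = 0 := by
  have : teichSeries p 0 = 0 := by ext x : 2; simp [teichSeries]
  rw [ofCoeffs, this, map_zero]

theorem isUnit_or_eq_zero (A : MalcevNeumann p) : IsUnit A ∨ A = 0 := by
  obtain ⟨α, rfl⟩ := ofCoeffs_surjective A
  by_cases h : α = 0
  · right
    rw [h, ofCoeffs_zero]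
  · left
    refine IsUnit.map (mk p) (HahnSeries.isUnit_iff.2 ?_)
    have hs := HahnSeries.support_nonempty_iff.2 h
    have hmem := α.isWF_support.min_mem hs
    have hord : (teichSeries p α).orderTop = ((α.isWF_support.min hs : ℚ) : WithTop ℚ) := by
      refine HahnSeries.orderTop_eq_of_le ?_ ?_
      · intro h0
        have h1 := congrArg WittVector.constantCoeff h0
        rw [map_zero] at h1
        exact hmem h1
      · intro y hy
        refine α.isWF_support.min_le hs fun h0 => hy ?_
        change WittVector.teichmuller p (α.coeff y) = 0
        rw [h0, WittVector.teichmuller_zero]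
    have hne : teichSeries p α ≠ 0 := by
      rw [← HahnSeries.orderTop_ne_top, hord]
      exact WithTop.coe_ne_top
    rw [HahnSeries.leadingCoeff_of_ne_zero hne]
    simp only [hord, WithTop.untop_coe]
    have hu : IsUnit (α.coeff (α.isWF_support.min hs)) := IsUnit.mk0 _ hmem
    exact hu.map (WittVector.teichmuller p)

instance : Nontrivial (MalcevNeumann p) := by
  refine ⟨ofCoeffs p 0, ofCoeffs p (HahnSeries.single 0 1), fun h => ?_⟩
  exact HahnSeries.single_ne_zero one_ne_zero (ofCoeffs_injective h).symm

noncomputable instance : Field (MalcevNeumann p) := Field.ofIsUnitOrEqZero isUnit_or_eq_zero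

/-! ### Newton polygons. A polynomial of degree `n` is written `∑ a_{n-i} T^i`; the point `(i, v(a_i))`
thus comes from the coefficient of `T^{n-i}`. -/

open Polynomial

/-- The part of the plane on or above the Newton polygon of `P`: the convex hull of the points
`(i, v(a_i))`, `0 ≤ i ≤ n`, together with the point at infinity of the positive vertical axis
(so vanishing coefficients contribute nothing). The Newton polygon is its lower boundary. -/
def newtonRegion (P : (MalcevNeumann p)[X]) : Set (ℚ × ℚ) :=
  convexHull ℚ {w | ∃ i : ℕ, i ≤ P.natDegree ∧ w.1 = i ∧
    val (P.coeff (P.natDegree - i)) ≤ (w.2 : WithTop ℚ)}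

/-- `i` is a breakpoint if `(i, v(a_i))` is a vertex of the Newton polygon. -/
def IsBreakpoint (P : (MalcevNeumann p)[X]) (i : ℕ) : Prop :=
  i ≤ P.natDegree ∧ ∃ y : ℚ, val (P.coeff (P.natDegree - i)) = (y : WithTop ℚ) ∧
    ((i : ℚ), y) ∈ (newtonRegion P).extremePoints ℚ

/-- The largest breakpoint less than the degree. -/
noncomputable def maxBreakpoint (P : (MalcevNeumann p)[X]) : ℕ :=
  sSup {i | i < P.natDegree ∧ IsBreakpoint P i}

/-- The valuation as a rational number, for nonzero elements. -/
noncomputable def valRat (α : MalcevNeumann p) : ℚ := (val α).untopD 0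

/-- The largest slope `(v(a_n) - v(a_m)) / (n - m)`, `m` the largest breakpoint, of the Newton
polygon of a nonconstant polynomial with `a_n = P(0) ≠ 0`. -/
noncomputable def maxSlope (P : (MalcevNeumann p)[X]) : ℚ :=
  (valRat (P.coeff 0) - valRat (P.coeff (P.natDegree - maxBreakpoint P))) /
    ((P.natDegree : ℚ) - maxBreakpoint P)

/-- The residue polynomial
`∑_{k=0}^{n-m} C_0(a_{n-k} p^{-v(a_m) - s(n-m-k)}) T^k`,
where `m` is the largest breakpoint and `s` the largest slope. -/
noncomputable def residuePoly (P : (MalcevNeumann p)[X]) : (Fpbar p)[X] :=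
  ∑ k ∈ Finset.range (P.natDegree - maxBreakpoint P + 1),
    monomial k (coeffAt 0 (P.coeff k *
      ppow p (-valRat (P.coeff (P.natDegree - maxBreakpoint P))
        - maxSlope P * ((P.natDegree : ℚ) - maxBreakpoint P - k))))

/-- The finite stages of the transfinite Newton algorithm for `f`: `r i` is the value of the
variable `r` after `i` passes through the loop, and `c i` is the root of the residue polynomial
of `Φ = f(T + r i)` that is chosen in the following pass. The loop stops when `Φ(0) = 0`; from
then on `r` is kept constant. -/
structure IsNewtonRun (f : (MalcevNeumann p)[X]) (c : ℕ → Fpbar p) (r : ℕ → MalcevNeumann p) :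
    Prop where
  init : r 0 = 0
  root : ∀ i, (f.comp (X + C (r i))).coeff 0 ≠ 0 →
    (residuePoly (f.comp (X + C (r i)))).IsRoot (c i)
  step : ∀ i, (f.comp (X + C (r i))).coeff 0 ≠ 0 →
    r (i + 1) = r i + teich p (c i) * ppow p (maxSlope (f.comp (X + C (r i))))
  halt : ∀ i, (f.comp (X + C (r i))).coeff 0 = 0 → r (i + 1) = r i

end MalcevNeumann

/-! ### Hahn series: supports of products and powers, Frobenius in characteristic `p`. -/

namespace HahnSeries

variable {R S : Type*}

/-! Over an algebraically closed field, `f(T + r)` is a product of factors `T - (μ - r)` over the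
roots `μ` of `f`. The largest slope is then the largest valuation of a `μ - r`, and the roots of the
residue polynomial are the leading coefficients of the differences attaining it (`newton_step`). So
the algorithm reads off, term by term, canonical expansions of roots. What is needed is that `𝕃_p`
is algebraically closed, together with the expansions of the primitive `p^n`-th roots of unity below
`1/(p^(n-2)(p-1))`.

Algebraic closedness is the transfinite Newton algorithm in the form of Zorn's lemma: balls centred
at approximate roots are nested, spherical completeness bounds chains, and a maximal ball can be
refined unless its polynomial has a root.

For the expansions write `e_N = 1/(p^N(p-1))`. Carries in `𝕃_p` move exponents up by at least `1`,
so on integral elements, below exponent `1`, taking `p`-th powers acts on expansions by Frobenius,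
with exponents multiplied by `p`. This reduces order `p^(N+1)` to order `p^N`, down to the following
two computations.

Order `p`: if `η` has leading term `w = [c]p^(e_0)` after `1`, then `c^(p-1) = -1`, so `w^p = -pw`.
With `E` the exponential truncated below degree `p`, `E(w)^p = E(w^p) + pw` up to small error, which
is nearly `1`; hence `η` agrees with `E(w)` up to valuation `1 + e_0` (`sub_expVal_mem`).

Order `p^2`: put `w = [c]p^(e_1)` and `D = ζ - E(w)`. Comparing `ζ^p` with `E(w^p)` gives `D^p + pD
+ pw = 0` modulo valuation `1 + e_0` (`sub_expVal_equation`). On coefficients this is a recursion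
along `x ↦ (1 + x)/p`, a contraction with fixed point `e_0`. The source `pw` creates a term at `e_0
- 1/p^2`, and the contraction carries `e_0 - 1/p^l` to `e_0 - 1/p^(l+1)`; as `c^p = -c`, every
coefficient is `c` (`coeffAt_sub_expVal`).

Finally, roots of unity with a different coefficient at `e_(n-1)` separate from the partial sums
there. Hence the residue polynomial has a single root at every pass except the one choosing `c_1`,
and the run is determined by that choice. -/

theorem coeff_mul_eq_zero_of_lt [Semiring R] {a b : HahnSeries ℚ R} {m m' : ℚ}
    (ha : ∀ y < m, a.coeff y = 0) (hb : ∀ y < m', b.coeff y = 0) {x : ℚ} (hx : x < m + m') :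
    (a * b).coeff x = 0 := by
  by_contra h
  obtain ⟨y, hy, z, hz, rfl⟩ := support_mul_subset ((mem_support _ _).2 h)
  have h1 : m ≤ y := not_lt.1 fun h1 => hy (ha y h1)
  have h2 : m' ≤ z := not_lt.1 fun h1 => hz (hb z h1)
  linarith

theorem coeff_add_mul_of_lt [Semiring R] {a b : HahnSeries ℚ R} {m m' : ℚ}
    (ha : ∀ y < m, a.coeff y = 0) (hb : ∀ y < m', b.coeff y = 0) :
    (a * b).coeff (m + m') = a.coeff m * b.coeff m' := by
  rw [coeff_mul]
  rw [Finset.sum_eq_single (m, m')]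
  · rintro ⟨y, z⟩ hyz hne
    rw [Finset.mem_antidiagonal] at hyz
    obtain ⟨hy, hz, hyz⟩ := hyz
    have h1 : m ≤ y := not_lt.1 fun h1 => hy (ha y h1)
    have h2 : m' ≤ z := not_lt.1 fun h1 => hz (hb z h1)
    exact absurd (Prod.ext (by simp at hyz ⊢; linarith) (by simp at hyz ⊢; linarith)) hne
  · intro h
    simp only [Finset.mem_antidiagonal, mem_support, ne_eq, and_true, not_and_or, not_not] at h
    rcases h with h | h <;> simp [h]

theorem coeff_pow_eq_zero_of_lt [Semiring R] {a : HahnSeries ℚ R} {m : ℚ}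
    (ha : ∀ y < m, a.coeff y = 0) (k : ℕ) {x : ℚ} (hx : x < k * m) : (a ^ k).coeff x = 0 := by
  induction k generalizing x with
  | zero =>
    rw [pow_zero, coeff_one, if_neg]
    rintro rfl
    simp at hx
  | succ k ih =>
    rw [pow_succ]
    exact coeff_mul_eq_zero_of_lt (m := k * m) (fun y hy => ih hy) ha (by push_cast at hx; linarith)

theorem coeff_mul_eq_zero_of_gt [Semiring R] {a b : HahnSeries ℚ R} {m m' : ℚ}
    (ha : ∀ y, m ≤ y → a.coeff y = 0) (hb : ∀ y, m' ≤ y → b.coeff y = 0) {x : ℚ}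
    (hx : m + m' ≤ x) : (a * b).coeff x = 0 := by
  by_contra h
  obtain ⟨y, hy, z, hz, rfl⟩ := support_mul_subset ((mem_support _ _).2 h)
  have h1 : y < m := not_le.1 fun h1 => hy (ha y h1)
  have h2 : z < m' := not_le.1 fun h1 => hz (hb z h1)
  simp only at hx
  linarith

/-- The exponent is a successor because `a ^ 0 = 1` has a nonzero coefficient at `0`, the bound
itself. -/
theorem coeff_pow_eq_zero_of_gt [Semiring R] {a : HahnSeries ℚ R} {m : ℚ}
    (ha : ∀ y, m ≤ y → a.coeff y = 0) (k : ℕ) {x : ℚ} (hx : (k + 1 : ℕ) * m ≤ x) :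
    (a ^ (k + 1)).coeff x = 0 := by
  induction k generalizing x with
  | zero => simpa using ha x (by simpa using hx)
  | succ k ih =>
    rw [pow_succ]
    exact coeff_mul_eq_zero_of_gt (m := (k + 1 : ℕ) * m) (fun y hy => ih hy) ha
      (by push_cast at hx ⊢; linarith)

theorem map_pow_coeff [Semiring R] [Semiring S] (f : R →+* S) (a : HahnSeries ℚ R) (k : ℕ) :
    (a ^ k).map f = a.map f ^ k := by
  induction k with
  | zero =>
    ext x
    rw [pow_zero, pow_zero, map_coeff, coeff_one, coeff_one]
    split_ifs <;> simp
  | succ k ih =>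
    rw [pow_succ, pow_succ, ← ih]
    exact HahnSeries.map_mul (f : R →ₙ+* S)

/-- Frobenius is additive, so split `f` into its part below `x`, its term at `x` and its part above.
The outer powers stay strictly on their sides of `p * x`; above, this uses that a well-ordered
support has a least element. -/
theorem coeff_mul_pow_char (p : ℕ) [hp : Fact p.Prime] [CommRing R] [CharP R p]
    (f : HahnSeries ℚ R) (x : ℚ) : (f ^ p).coeff (p * x) = f.coeff x ^ p := by
  classical
  have : CharP (HahnSeries ℚ R) p :=
    charP_of_injective_ringHom (f := (HahnSeries.C : R →+* HahnSeries ℚ R)) C_injective p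
  have hpos : (0 : ℚ) < p := by exact_mod_cast hp.out.pos
  let g : HahnSeries ℚ R := f - truncLT x f - single x (f.coeff x)
  have hg : ∀ y, g.coeff y = if x < y then f.coeff y else 0 := by
    intro y
    simp only [g, coeff_sub, HahnSeries.coeff_truncLT, coeff_single]
    rcases lt_trichotomy x y with h | h | h
    · simp [h, h.ne', h.le]
    · simp [h]
    · simp [h, h.ne, h.le]
  have hf : f = truncLT x f + single x (f.coeff x) + g := by simp only [g]; ring
  have h1 : ((truncLT x f) ^ p).coeff (p * x) = 0 := by
    obtain ⟨k, hk⟩ := Nat.exists_eq_succ_of_ne_zero hp.out.ne_zero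
    rw [hk]
    exact coeff_pow_eq_zero_of_gt (m := x) (fun y hy => coeff_truncLT_of_le hy f) k le_rfl
  have h2 : (g ^ p).coeff (p * x) = 0 := by
    rcases eq_or_ne g 0 with h | h
    · rw [h, zero_pow hp.out.ne_zero, coeff_zero]
    have hs := support_nonempty_iff.2 h
    have hmem := g.isWF_support.min_mem hs
    have hlt : x < g.isWF_support.min hs := by
      rw [mem_support, hg] at hmem
      by_contra hc
      exact hmem (if_neg hc)
    refine coeff_pow_eq_zero_of_lt (m := g.isWF_support.min hs) ?_ p (by gcongr)
    intro y hy
    by_contra hc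
    exact g.isWF_support.not_lt_min hs hc hy
  conv_lhs => rw [hf]
  rw [add_pow_char, add_pow_char, coeff_add, coeff_add, h1, h2, single_pow]
  simp

end HahnSeries

/-! ### Arithmetic of canonical expansions below the first carry, and leading terms. -/

namespace MalcevNeumann

variable {p : ℕ} [hp : Fact p.Prime]

open HahnSeries

theorem expansion_ofCoeffs (α : HahnSeries ℚ (Fpbar p)) : expansion (ofCoeffs p α) = α :=
  (Equiv.ofBijective (ofCoeffs p) ⟨ofCoeffs_injective, ofCoeffs_surjective⟩).symm_apply_apply α

theorem ofCoeffs_expansion (A : MalcevNeumann p) : ofCoeffs p (expansion A) = A :=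
  (Equiv.ofBijective (ofCoeffs p) ⟨ofCoeffs_injective, ofCoeffs_surjective⟩).apply_symm_apply A

theorem coeffAt_ofCoeffs (α : HahnSeries ℚ (Fpbar p)) (x : ℚ) :
    coeffAt x (ofCoeffs p α) = α.coeff x := by rw [coeffAt, expansion_ofCoeffs]

theorem coeffAt_zero (x : ℚ) : coeffAt x (0 : MalcevNeumann p) = 0 := by
  rw [← ofCoeffs_zero, coeffAt_ofCoeffs, coeff_zero]

theorem teichSeries_coeff (α : HahnSeries ℚ (Fpbar p)) (x : ℚ) :
    (teichSeries p α).coeff x = WittVector.teichmuller p (α.coeff x) := rfl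

theorem teichSeries_coeff_eq_zero {α : HahnSeries ℚ (Fpbar p)} {x : ℚ} (h : α.coeff x = 0) :
    (teichSeries p α).coeff x = 0 := by
  rw [teichSeries_coeff, h, WittVector.teichmuller_zero]

/-- A series with exponents `≥ m` reduces to its canonical expansion below `m + 1`. -/
theorem coeffAt_mk_of_lt {a : HahnSeries ℚ (Wbar p)} {m : ℚ} (ha : ∀ y < m, a.coeff y = 0)
    {x : ℚ} (hx : x < m + 1) : coeffAt x (mk p a) = (a.coeff x).coeff 0 := by
  obtain ⟨α, hα⟩ := ofCoeffs_surjective (mk p a)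
  rw [← hα, coeffAt_ofCoeffs]
  obtain ⟨b, hb⟩ := Ideal.mem_span_singleton.1
    (Ideal.Quotient.eq.1 hα.symm : a - teichSeries p α ∈ nullIdeal p)
  have hc : ∀ y, a.coeff y - WittVector.teichmuller p (α.coeff y)
      = b.coeff (y - 1) - (p : Wbar p) * b.coeff y := by
    intro y
    rw [← coeff_sub_mul, ← hb]
    rfl
  have hp0 : (p : Wbar p) ≠ 0 := WittVector.p_nonzero p (Fpbar p)
  have hp1 : WittVector.constantCoeff (p : Wbar p) = 0 := by
    rw [map_natCast]; exact CharP.cast_eq_zero _ _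
  -- At the first exponent `y < m` with `b_y ≠ 0` the relation reads `[α_y] = p b_y`; reducing
  -- modulo `p` gives `α_y = 0`, so `b_y = 0`.
  have hbm : ∀ y < m, b.coeff y = 0 := by
    intro y hy
    by_contra h
    have hbs : b.support.Nonempty := ⟨y, h⟩
    have hmem := b.isWF_support.min_mem hbs
    have hle : b.isWF_support.min hbs ≤ y := b.isWF_support.min_le hbs h
    have h2 := hc (b.isWF_support.min hbs)
    have h3 : b.coeff (b.isWF_support.min hbs - 1) = 0 := by
      by_contra h4
      exact b.isWF_support.not_lt_min hbs h4 (by linarith)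
    rw [ha _ (hle.trans_lt hy), h3, zero_sub, zero_sub, neg_inj] at h2
    have h4 := congrArg WittVector.constantCoeff h2
    rw [map_mul, hp1, zero_mul] at h4
    have h5 : α.coeff (b.isWF_support.min hbs) = 0 := by simpa using h4
    rw [h5, WittVector.teichmuller_zero, eq_comm] at h2
    exact hmem ((mul_eq_zero.1 h2).resolve_left hp0)
  have h1 := hc x
  rw [hbm _ (by linarith), zero_sub, sub_eq_iff_eq_add] at h1
  have h2 := congrArg WittVector.constantCoeff h1
  rw [map_add, map_neg, map_mul, hp1, zero_mul, neg_zero, zero_add] at h2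
  simpa using h2.symm

/-- The elements of valuation at least `x`. -/
noncomputable def valGe (p : ℕ) [Fact p.Prime] (x : ℚ) : AddSubgroup (MalcevNeumann p) where
  carrier := {A | ∀ y < x, coeffAt y A = 0}
  zero_mem' := fun y _ => coeffAt_zero y
  add_mem' {A B} hA hB y hy := by
    rw [← ofCoeffs_expansion A, ← ofCoeffs_expansion B, ofCoeffs, ofCoeffs, ← map_add,
      coeffAt_mk_of_lt (m := x) ?_ (by linarith), coeff_add,
      teichSeries_coeff_eq_zero (hA y hy), teichSeries_coeff_eq_zero (hB y hy)]
    · simp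
    · intro y hy
      rw [coeff_add, teichSeries_coeff_eq_zero (hA y hy), teichSeries_coeff_eq_zero (hB y hy),
        add_zero]
  neg_mem' {A} hA y hy := by
    rw [← ofCoeffs_expansion A, ofCoeffs, ← map_neg,
      coeffAt_mk_of_lt (m := x) ?_ (by linarith), coeff_neg, teichSeries_coeff_eq_zero (hA y hy)]
    · simp
    · intro y hy
      rw [coeff_neg, teichSeries_coeff_eq_zero (hA y hy), neg_zero]

theorem valGe_mono {x y : ℚ} (h : y ≤ x) {A : MalcevNeumann p} (hA : A ∈ valGe p x) :
    A ∈ valGe p y := fun z hz => hA z (hz.trans_le h)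

theorem mk_mem_valGe {a : HahnSeries ℚ (Wbar p)} {m : ℚ} (ha : ∀ y < m, a.coeff y = 0) :
    mk p a ∈ valGe p m := by
  intro y hy
  rw [coeffAt_mk_of_lt ha (by linarith), ha y hy, WittVector.zero_coeff]

theorem exists_mk_eq {A : MalcevNeumann p} {m : ℚ} (hA : A ∈ valGe p m) :
    ∃ a : HahnSeries ℚ (Wbar p), mk p a = A ∧ ∀ y < m, a.coeff y = 0 :=
  ⟨teichSeries p (expansion A), ofCoeffs_expansion A,
    fun y hy => teichSeries_coeff_eq_zero (hA y hy)⟩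

/-- Teichmüller lifts are additive only modulo `p`; the corrections are multiples of `p = p^1`, so
from terms at exponents `≥ m` they reach only exponents `≥ m + 1`. -/
theorem coeffAt_add {m x : ℚ} {A B : MalcevNeumann p} (hA : A ∈ valGe p m) (hB : B ∈ valGe p m)
    (hx : x < m + 1) : coeffAt x (A + B) = coeffAt x A + coeffAt x B := by
  obtain ⟨a, rfl, ha⟩ := exists_mk_eq hA
  obtain ⟨b, rfl, hb⟩ := exists_mk_eq hB
  rw [← map_add, coeffAt_mk_of_lt ha hx, coeffAt_mk_of_lt hb hx, coeffAt_mk_of_lt _ hx, coeff_add]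
  · exact map_add (WittVector.constantCoeff (R := Fpbar p) (p := p)) _ _
  · intro y hy
    rw [coeff_add, ha y hy, hb y hy, add_zero]

theorem coeffAt_neg {m x : ℚ} {A : MalcevNeumann p} (hA : A ∈ valGe p m)
    (hx : x < m + 1) : coeffAt x (-A) = -coeffAt x A := by
  have h := coeffAt_add hA (neg_mem hA) hx
  rw [add_neg_cancel, coeffAt_zero] at h
  exact (neg_eq_of_add_eq_zero_right h.symm).symm

theorem coeffAt_sub {m x : ℚ} {A B : MalcevNeumann p} (hA : A ∈ valGe p m) (hB : B ∈ valGe p m)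
    (hx : x < m + 1) : coeffAt x (A - B) = coeffAt x A - coeffAt x B := by
  rw [sub_eq_add_neg, coeffAt_add hA (neg_mem hB) hx, coeffAt_neg hB hx, sub_eq_add_neg]

theorem coeffAt_sum {ι : Type*} (s : Finset ι) (f : ι → MalcevNeumann p) {m x : ℚ}
    (hf : ∀ i ∈ s, f i ∈ valGe p m) (hx : x < m + 1) :
    coeffAt x (∑ i ∈ s, f i) = ∑ i ∈ s, coeffAt x (f i) := by
  classical
  induction s using Finset.induction_on with
  | empty => simp [coeffAt_zero]
  | insert i s hi ih =>
    rw [Finset.sum_insert hi, Finset.sum_insert hi, coeffAt_add (m := m)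
      (hf i (Finset.mem_insert_self i s))
      (sum_mem fun j hj => hf j (Finset.mem_insert_of_mem hj)) hx,
      ih fun j hj => hf j (Finset.mem_insert_of_mem hj)]

theorem mul_mem_valGe {m m' : ℚ} {A B : MalcevNeumann p} (hA : A ∈ valGe p m)
    (hB : B ∈ valGe p m') : A * B ∈ valGe p (m + m') := by
  obtain ⟨a, rfl, ha⟩ := exists_mk_eq hA
  obtain ⟨b, rfl, hb⟩ := exists_mk_eq hB
  rw [← map_mul]
  exact mk_mem_valGe fun y hy => coeff_mul_eq_zero_of_lt ha hb hy

theorem coeffAt_add_mul {m m' : ℚ} {A B : MalcevNeumann p} (hA : A ∈ valGe p m)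
    (hB : B ∈ valGe p m') : coeffAt (m + m') (A * B) = coeffAt m A * coeffAt m' B := by
  obtain ⟨a, rfl, ha⟩ := exists_mk_eq hA
  obtain ⟨b, rfl, hb⟩ := exists_mk_eq hB
  rw [← map_mul, coeffAt_mk_of_lt (m := m + m') (fun y hy => coeff_mul_eq_zero_of_lt ha hb hy)
    (by linarith), coeffAt_mk_of_lt ha (by linarith), coeffAt_mk_of_lt hb (by linarith),
    coeff_add_mul_of_lt ha hb]
  exact map_mul (WittVector.constantCoeff (R := Fpbar p) (p := p)) _ _

theorem mk_single_mem_valGe (x : ℚ) (w : Wbar p) : mk p (single x w) ∈ valGe p x :=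
  mk_mem_valGe fun _ hy => coeff_single_of_ne hy.ne

theorem coeffAt_mk_single {x y : ℚ} (w : Wbar p) (hy : y < x + 1) :
    coeffAt y (mk p (single x w)) = if y = x then w.coeff 0 else 0 := by
  rw [coeffAt_mk_of_lt (m := x) (fun _ hy => coeff_single_of_ne hy.ne) hy, coeff_single]
  split_ifs <;> simp

theorem teich_mul_ppow (c : Fpbar p) (x : ℚ) :
    teich p c * ppow p x = mk p (single x (WittVector.teichmuller p c)) := by
  change mk p (HahnSeries.C _) * mk p _ = _
  rw [← map_mul, C_mul_eq_smul]
  congr 1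
  rw [← HahnSeries.single_zero_mul_eq_smul, single_mul_single, zero_add, mul_one]

theorem coeffAt_teich_mul_ppow (c : Fpbar p) (x y : ℚ) :
    coeffAt y (teich p c * ppow p x) = if y = x then c else 0 := by
  have : teich p c * ppow p x = ofCoeffs p (single x c) := by
    rw [teich_mul_ppow, ofCoeffs]
    congr 1
    ext y : 2
    rw [teichSeries_coeff, coeff_single, coeff_single]
    split_ifs <;> simp
  rw [this, coeffAt_ofCoeffs, coeff_single]
  split_ifs <;> rfl

theorem ppow_zero : ppow p 0 = 1 := map_one (mk p)

theorem ppow_add (x y : ℚ) : ppow p (x + y) = ppow p x * ppow p y := by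
  rw [ppow, ppow, ppow, ← map_mul, single_mul_single, one_mul]

theorem ppow_nsmul (x : ℚ) (k : ℕ) : ppow p (k * x) = ppow p x ^ k := by
  rw [ppow, ppow, ← map_pow, single_pow, one_pow, nsmul_eq_mul]

theorem ppow_one : ppow p 1 = (p : MalcevNeumann p) := by
  have h : mk p (single (1 : ℚ) (1 : Wbar p) - HahnSeries.C (p : Wbar p)) = 0 :=
    Ideal.Quotient.eq_zero_iff_mem.2 (Ideal.mem_span_singleton_self _)
  rw [map_sub, sub_eq_zero] at h
  rw [ppow, h, map_natCast, map_natCast]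

theorem ppow_mul_ppow_neg (x : ℚ) : ppow p x * ppow p (-x) = 1 := by
  rw [← ppow_add, add_neg_cancel, ppow_zero]

theorem ppow_ne_zero (x : ℚ) : ppow p x ≠ 0 := left_ne_zero_of_mul_eq_one (ppow_mul_ppow_neg x)

theorem ppow_mem_valGe (x : ℚ) : ppow p x ∈ valGe p x := mk_single_mem_valGe x 1

theorem one_mem_valGe : (1 : MalcevNeumann p) ∈ valGe p 0 := by
  rw [← ppow_zero]; exact ppow_mem_valGe 0

theorem coeffAt_ppow (x y : ℚ) : coeffAt y (ppow p x) = if y = x then 1 else 0 := by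
  have := coeffAt_teich_mul_ppow (1 : Fpbar p) x y
  rwa [map_one, one_mul] at this

theorem coeffAt_one (x : ℚ) : coeffAt x (1 : MalcevNeumann p) = if x = 0 then 1 else 0 := by
  rw [← ppow_zero, coeffAt_ppow]

/-- Multiplication by `p^y` shifts canonical expansions. -/
theorem coeffAt_mul_ppow (A : MalcevNeumann p) (x y : ℚ) :
    coeffAt x (A * ppow p y) = coeffAt (x - y) A := by
  have h : A * ppow p y = ofCoeffs p (expansion A * single y 1) := by
    conv_lhs => rw [← ofCoeffs_expansion A]
    rw [ofCoeffs, ppow, ← map_mul, ofCoeffs]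
    congr 1
    ext z : 2
    rw [teichSeries_coeff, ← sub_add_cancel z y, coeff_mul_single_add, coeff_mul_single_add,
      mul_one, mul_one, teichSeries_coeff]
  rw [h, coeffAt_ofCoeffs]
  conv_lhs => rw [← sub_add_cancel x y]
  rw [coeff_mul_single_add, mul_one, coeffAt]

theorem mul_ppow_mem_valGe {A : MalcevNeumann p} {x y : ℚ} :
    A * ppow p y ∈ valGe p x ↔ A ∈ valGe p (x - y) := by
  refine ⟨fun h z hz => ?_, fun h z hz => ?_⟩
  · have := h (z + y) (by linarith)
    rwa [coeffAt_mul_ppow, add_sub_cancel_right] at this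
  · rw [coeffAt_mul_ppow]
    exact h _ (by linarith)

theorem coeffAt_prime_mul (A : MalcevNeumann p) (x : ℚ) :
    coeffAt x ((p : MalcevNeumann p) * A) = coeffAt (x - 1) A := by
  rw [mul_comm, ← ppow_one, coeffAt_mul_ppow]

theorem prime_mul_mem_valGe {A : MalcevNeumann p} {x : ℚ} :
    (p : MalcevNeumann p) * A ∈ valGe p x ↔ A ∈ valGe p (x - 1) := by
  rw [mul_comm, ← ppow_one, mul_ppow_mem_valGe]

theorem pow_mem_valGe {m : ℚ} {A : MalcevNeumann p} (hA : A ∈ valGe p m) (k : ℕ) :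
    A ^ k ∈ valGe p (k * m) := by
  induction k with
  | zero => simpa using one_mem_valGe
  | succ k ih =>
    rw [pow_succ]
    have := mul_mem_valGe ih hA
    convert this using 2
    push_cast
    ring

theorem coeffAt_mul_pow {m : ℚ} {A : MalcevNeumann p} (hA : A ∈ valGe p m) (k : ℕ) :
    coeffAt (k * m) (A ^ k) = coeffAt m A ^ k := by
  induction k with
  | zero => simp [coeffAt_one]
  | succ k ih =>
    rw [pow_succ, pow_succ, ← ih, ← coeffAt_add_mul (pow_mem_valGe hA k) hA]
    congr 1
    push_cast
    ring

theorem pow_mem_valGe_zero {A : MalcevNeumann p} (hA : A ∈ valGe p 0) (k : ℕ) :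
    A ^ k ∈ valGe p 0 := by simpa using pow_mem_valGe hA k

theorem coeffAt_zero_pow {A : MalcevNeumann p} (hA : A ∈ valGe p 0) (k : ℕ) :
    coeffAt 0 (A ^ k) = coeffAt 0 A ^ k := by simpa using coeffAt_mul_pow hA k

/-- Below `p m + 1`, the canonical expansion of `A ^ p` is obtained by applying Frobenius. -/
theorem coeffAt_prime_mul_pow {m x : ℚ} {A : MalcevNeumann p} (hA : A ∈ valGe p m)
    (hx : p * x < p * m + 1) : coeffAt (p * x) (A ^ p) = coeffAt x A ^ p := by
  obtain ⟨a, rfl, ha⟩ := exists_mk_eq hA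
  have hpos : (0 : ℚ) < p := by exact_mod_cast hp.out.pos
  have h1 : (1 : ℚ) ≤ p := by exact_mod_cast hp.out.one_le
  have hxm : x < m + 1 := by
    have : p * x < p * (m + 1) := by linarith
    exact lt_of_mul_lt_mul_left this hpos.le
  rw [← map_pow, coeffAt_mk_of_lt (fun y hy => coeff_pow_eq_zero_of_lt ha p hy) hx,
    coeffAt_mk_of_lt ha hxm]
  have h2 := coeff_mul_pow_char p (a.map (WittVector.constantCoeff (R := Fpbar p) (p := p))) x
  rw [← HahnSeries.map_pow_coeff, HahnSeries.map_coeff, HahnSeries.map_coeff] at h2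
  exact h2

/-- A nonzero element has a leading term. -/
theorem exists_leading {A : MalcevNeumann p} (hA : A ≠ 0) :
    ∃ x, A ∈ valGe p x ∧ coeffAt x A ≠ 0 := by
  have h : expansion A ≠ 0 := by
    intro h
    exact hA (by rw [← ofCoeffs_expansion A, h, ofCoeffs_zero])
  have hs := HahnSeries.support_nonempty_iff.2 h
  refine ⟨(expansion A).isWF_support.min hs, fun y hy => ?_, (expansion A).isWF_support.min_mem hs⟩
  by_contra hc
  exact (expansion A).isWF_support.not_lt_min hs hc hy

theorem le_of_mem_valGe {A : MalcevNeumann p} {x y : ℚ} (hx : A ∈ valGe p x)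
    (hy : coeffAt y A ≠ 0) : x ≤ y := not_lt.1 fun h => hy (hx y h)

theorem mem_valGe_of_pow {A : MalcevNeumann p} {x : ℚ} {k : ℕ} (hk : k ≠ 0)
    (h : A ^ k ∈ valGe p (k * x)) : A ∈ valGe p x := by
  rcases eq_or_ne A 0 with rfl | h0
  · exact zero_mem _
  obtain ⟨y, hy, hc⟩ := exists_leading h0
  refine valGe_mono ?_ hy
  have h1 := coeffAt_mul_pow hy k
  have h2 := le_of_mem_valGe h (by rw [h1]; exact pow_ne_zero _ hc)
  exact le_of_mul_le_mul_left h2 (by positivity)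

theorem val_eq {A : MalcevNeumann p} {x : ℚ} (hA : A ∈ valGe p x) (hx : coeffAt x A ≠ 0) :
    val A = x :=
  orderTop_eq_of_le hx fun _ hy => le_of_mem_valGe hA hy

theorem le_of_val_le {A : MalcevNeumann p} {x y : ℚ} (hA : A ∈ valGe p x) (h : val A ≤ y) :
    x ≤ y := by
  have : (x : WithTop ℚ) ≤ val A :=
    le_orderTop_iff_forall.2 fun j hj => hA j (WithTop.coe_lt_coe.1 hj)
  exact WithTop.coe_le_coe.1 (this.trans h)

theorem valRat_eq {A : MalcevNeumann p} {x : ℚ} (hA : A ∈ valGe p x) (hx : coeffAt x A ≠ 0) :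
    valRat A = x := by rw [valRat, val_eq hA hx]; rfl

end MalcevNeumann

namespace MalcevNeumann

variable {p : ℕ} [hp : Fact p.Prime]

open HahnSeries (truncLT coeff_truncLT_of_lt coeff_truncLT_of_le)

/-! ### Truncation and spherical completeness -/

/-- With disjoint supports no two Teichmüller lifts are added, so there is no carry at any exponent.
-/
theorem ofCoeffs_add_of_disjoint {α β : HahnSeries ℚ (Fpbar p)}
    (h : ∀ x, α.coeff x = 0 ∨ β.coeff x = 0) :
    ofCoeffs p (α + β) = ofCoeffs p α + ofCoeffs p β := by
  rw [ofCoeffs, ofCoeffs, ofCoeffs, ← map_add]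
  congr 1
  ext x : 2
  rw [HahnSeries.coeff_add, teichSeries_coeff, teichSeries_coeff, teichSeries_coeff,
    HahnSeries.coeff_add]
  rcases h x with h | h <;> simp [h]

theorem eq_truncLT_add (A : MalcevNeumann p) (s : ℚ) :
    ∃ B ∈ valGe p s, A = ofCoeffs p (truncLT s (expansion A)) + B := by
  refine ⟨ofCoeffs p (expansion A - truncLT s (expansion A)), fun y hy => ?_, ?_⟩
  · rw [coeffAt_ofCoeffs, HahnSeries.coeff_sub, coeff_truncLT_of_lt hy, sub_self]
  · rw [← ofCoeffs_add_of_disjoint, add_sub_cancel, ofCoeffs_expansion]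
    intro x
    rcases lt_or_ge x s with h | h
    · right; rw [HahnSeries.coeff_sub, coeff_truncLT_of_lt h, sub_self]
    · left; exact coeff_truncLT_of_le h _

/-- Subtraction does not act coefficientwise in general. Splitting expansions at `s` keeps the
truncation apart from the rest, so changing an element by something of valuation `≥ s` leaves the
truncation intact. -/
theorem sub_mem_valGe_iff {A B : MalcevNeumann p} {s : ℚ} :
    A - B ∈ valGe p s ↔ ∀ x < s, coeffAt x A = coeffAt x B := by
  constructor
  · intro h x hx
    obtain ⟨D, hD, hB⟩ := eq_truncLT_add B s
    have hA : A = ofCoeffs p (truncLT s (expansion B)) + ofCoeffs p (expansion (D + (A - B))) := by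
      rw [ofCoeffs_expansion, ← add_assoc, ← hB, add_sub_cancel]
    have hE : ∀ y < s, (expansion (D + (A - B))).coeff y = 0 := add_mem hD h
    rw [hA, ← ofCoeffs_add_of_disjoint, coeffAt_ofCoeffs, HahnSeries.coeff_add, hE x hx, add_zero,
      coeff_truncLT_of_lt hx, coeffAt]
    intro y
    rcases lt_or_ge y s with h | h
    · exact Or.inr (hE y h)
    · exact Or.inl (coeff_truncLT_of_le h _)
  · intro h
    obtain ⟨D, hD, hA⟩ := eq_truncLT_add A s
    obtain ⟨E, hE, hB⟩ := eq_truncLT_add B s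
    have : truncLT s (expansion A) = truncLT s (expansion B) := by
      ext x
      rcases lt_or_ge x s with hx | hx
      · rw [coeff_truncLT_of_lt hx, coeff_truncLT_of_lt hx]
        exact h x hx
      · rw [coeff_truncLT_of_le hx, coeff_truncLT_of_le hx]
    rw [hA, hB, this, add_sub_add_left_eq_sub]
    exact sub_mem hD hE

/-- Spherical completeness: nested balls have a common point. -/
theorem exists_mem_balls (C : Set (MalcevNeumann p × ℚ))
    (hC : ∀ a ∈ C, ∀ b ∈ C, a.2 ≤ b.2 → b.1 - a.1 ∈ valGe p a.2) :
    ∃ r, ∀ a ∈ C, r - a.1 ∈ valGe p a.2 := by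
  classical
  -- At `x`, take the coefficient of any centre whose ball determines coefficients at `x`;
  -- nestedness makes the choice irrelevant.
  let f : ℚ → Fpbar p := fun x =>
    if h : ∃ a ∈ C, x < a.2 then coeffAt x (Classical.choose h).1 else 0
  have hf : ∀ a ∈ C, ∀ x < a.2, f x = coeffAt x a.1 := by
    intro a ha x hx
    have h : ∃ a ∈ C, x < a.2 := ⟨a, ha, hx⟩
    obtain ⟨hb, hxb⟩ := Classical.choose_spec h
    simp only [f, dif_pos h]
    rcases le_total a.2 (Classical.choose h).2 with hab | hab
    · exact sub_mem_valGe_iff.1 (hC _ ha _ hb hab) x hx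
    · exact (sub_mem_valGe_iff.1 (hC _ hb _ ha hab) x hxb).symm
  have hPWO : (Function.support f).IsPWO := by
    -- A strictly decreasing sequence in the support stays below its first term, where `f` agrees
    -- with one single centre, whose support is well-ordered.
    refine Set.partiallyWellOrderedOn_iff_exists_lt.2 fun u hu => ?_
    by_contra! hc
    have h0 : ∃ a ∈ C, u 0 < a.2 := by
      by_contra h
      exact hu 0 (dif_neg h)
    obtain ⟨a, ha, h0⟩ := h0
    have hlt : ∀ n, u n < a.2 := by
      intro n
      rcases Nat.eq_zero_or_pos n with rfl | hn
      · exact h0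
      · exact (hc 0 n hn).trans h0
    obtain ⟨m, n, hmn, hle⟩ := Set.partiallyWellOrderedOn_iff_exists_lt.1
      (expansion a.1).isPWO_support u fun n => by
        have := hu n
        rwa [Function.mem_support, hf a ha _ (hlt n)] at this
    exact absurd hle (not_le.2 (hc m n hmn))
  refine ⟨ofCoeffs p ⟨f, hPWO⟩, fun a ha => sub_mem_valGe_iff.2 fun x hx => ?_⟩
  rw [coeffAt_ofCoeffs]
  exact hf a ha x hx

/-! ### The valuation ring and its residue map -/

/-- The valuation ring. -/
noncomputable def integers (p : ℕ) [Fact p.Prime] : Subring (MalcevNeumann p) :=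
  { valGe p 0 with
    one_mem' := one_mem_valGe
    mul_mem' := fun {A B} hA hB => by
      have := mul_mem_valGe (p := p) hA hB
      rwa [add_zero] at this }

theorem mem_integers {A : MalcevNeumann p} : A ∈ integers p ↔ A ∈ valGe p 0 := Iff.rfl

/-- The residue map of the valuation ring. -/
noncomputable def red (p : ℕ) [Fact p.Prime] : integers p →+* Fpbar p where
  toFun A := coeffAt 0 (A : MalcevNeumann p)
  map_zero' := coeffAt_zero 0
  map_one' := by
    change coeffAt 0 (1 : MalcevNeumann p) = 1
    rw [coeffAt_one, if_pos rfl]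
  map_add' A B := coeffAt_add A.2 B.2 (by norm_num)
  map_mul' A B := by
    have := coeffAt_add_mul (p := p) A.2 B.2
    rwa [add_zero] at this

theorem red_apply (A : integers p) : red p A = coeffAt 0 (A : MalcevNeumann p) := rfl

theorem teich_mem_integers (c : Fpbar p) : teich p c ∈ integers p := by
  have h := coeffAt_teich_mul_ppow c 0
  rw [ppow_zero, mul_one] at h
  intro y hy
  rw [h, if_neg hy.ne]

theorem coeffAt_zero_teich (c : Fpbar p) : coeffAt 0 (teich p c) = c := by
  have h := coeffAt_teich_mul_ppow c 0 0
  rwa [ppow_zero, mul_one, if_pos rfl] at h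

/-! ### Rescaled reductions of polynomials and algebraic closedness. -/

open Polynomial

/-- `H` is the rescaling `p^e g(p^s T)` of `g`, with integral coefficients. -/
def IsReduction (g : (MalcevNeumann p)[X]) (s e : ℚ) (H : (integers p)[X]) : Prop :=
  ∀ k : ℕ, (H.coeff k : MalcevNeumann p) = g.coeff k * ppow p (e + k * s)

theorem isReduction_iff {g : (MalcevNeumann p)[X]} {s e : ℚ} {H : (integers p)[X]} :
    IsReduction g s e H ↔
      H.map (integers p).subtype = C (ppow p e) * g.comp (C (ppow p s) * X) := by
  rw [Polynomial.ext_iff]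
  refine forall_congr' fun k => ?_
  rw [coeff_map, coeff_C_mul, comp_C_mul_X_coeff, ppow_add, ppow_nsmul]
  change _ = _ ↔ (H.coeff k : MalcevNeumann p) = _
  rw [mul_left_comm]

/-- Moving the centre by an element of valuation `≥ s` becomes, after rescaling, an integral
translation; it therefore preserves the degree of the reduction. -/
theorem IsReduction.comp_X_add_C {g : (MalcevNeumann p)[X]} {s e : ℚ} {H : (integers p)[X]}
    (h : IsReduction g s e H) (u : integers p) :
    IsReduction (g.comp (X + C (u * ppow p s))) s e (H.comp (X + C u)) := by
  rw [isReduction_iff] at h ⊢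
  rw [Polynomial.map_comp, h, mul_comp, comp_assoc, comp_assoc]
  simp only [C_comp, Polynomial.map_add, map_X, map_C, mul_comp, X_comp, add_comp, C_mul]
  rw [mul_add, mul_comm (C (u : MalcevNeumann p))]
  rfl

theorem natDegree_map_red_comp (H : (integers p)[X]) (u : integers p) :
    ((H.comp (X + C u)).map (red p)).natDegree = (H.map (red p)).natDegree := by
  rw [Polynomial.map_comp, natDegree_comp, Polynomial.map_add, map_X, map_C, natDegree_X_add_C,
    mul_one]

theorem exists_isReduction {g : (MalcevNeumann p)[X]} {s e : ℚ}
    (h : ∀ k : ℕ, g.coeff k ∈ valGe p (-(e + k * s))) : ∃ H, IsReduction g s e H := by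
  have h' : ∀ k : ℕ, g.coeff k * ppow p (e + k * s) ∈ integers p := fun k =>
    mul_ppow_mem_valGe.2 (by rw [zero_sub]; exact h k)
  refine ⟨∑ k ∈ Finset.range (g.natDegree + 1), monomial k ⟨_, h' k⟩, fun k => ?_⟩
  rw [finsetSum_coeff]
  simp only [coeff_monomial, Finset.sum_ite_eq', Finset.mem_range]
  split_ifs with hk
  · rfl
  · rw [coeff_eq_zero_of_natDegree_lt (by omega), zero_mul]
    rfl

theorem IsReduction.coeff_mem {g : (MalcevNeumann p)[X]} {s e : ℚ} {H : (integers p)[X]}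
    (h : IsReduction g s e H) (k : ℕ) : g.coeff k ∈ valGe p (-(e + k * s)) := by
  have := (H.coeff k).2
  rw [h k, mem_integers, mul_ppow_mem_valGe, zero_sub] at this
  exact this

theorem IsReduction.coeff_map_red {g : (MalcevNeumann p)[X]} {s e : ℚ} {H : (integers p)[X]}
    (h : IsReduction g s e H) (k : ℕ) :
    (H.map (red p)).coeff k = coeffAt (-(e + k * s)) (g.coeff k) := by
  rw [coeff_map, red_apply, h k, coeffAt_mul_ppow, zero_sub]

/-- The largest slope of a polynomial with nonzero constant coefficient. -/
theorem exists_max_slope {g : (MalcevNeumann p)[X]} (h0 : g.coeff 0 ≠ 0) (hd : 1 ≤ g.natDegree) :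
    ∃ s, (∃ e H, IsReduction g s e H ∧ 1 ≤ (H.map (red p)).natDegree) ∧
      ∀ s' e' H', IsReduction g s' e' H' → 1 ≤ (H'.map (red p)).natDegree →
        s' ≤ s ∧ ((H'.map (red p)).coeff 0 = 0 → s' < s) := by
  classical
  have hv : ∀ k, ∃ x, g.coeff k ≠ 0 → g.coeff k ∈ valGe p x ∧ coeffAt x (g.coeff k) ≠ 0 := by
    intro k
    by_cases hk : g.coeff k = 0
    · exact ⟨0, fun h => absurd hk h⟩
    · obtain ⟨x, hx⟩ := exists_leading hk
      exact ⟨x, fun _ => hx⟩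
  choose v hv using hv
  let T := (Finset.Icc 1 g.natDegree).filter fun k => g.coeff k ≠ 0
  have hT : T.Nonempty := by
    refine ⟨g.natDegree, Finset.mem_filter.2 ⟨Finset.mem_Icc.2 ⟨hd, le_rfl⟩, ?_⟩⟩
    rw [coeff_natDegree, Ne, leadingCoeff_eq_zero]
    rintro rfl
    simp at hd
  have hTpos : ∀ k ∈ T, (0 : ℚ) < k := fun k hk => by
    exact_mod_cast (Finset.mem_Icc.1 (Finset.mem_filter.1 hk).1).1
  -- The slopes of the chords from the constant term's point to the others; the steepest one is the
  -- last edge of the Newton polygon.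
  obtain ⟨d, hdT, hmax⟩ := T.exists_max_image (fun k => (v 0 - v k) / (k : ℚ)) hT
  set s := (v 0 - v d) / (d : ℚ) with hs
  have hvs : ∀ k ∈ T, v 0 - v k ≤ k * s := fun k hk => by
    have := (div_le_iff₀ (hTpos k hk)).1 (hmax k hk)
    linarith
  have hds : v 0 - v d = d * s := by
    rw [hs]; field_simp [(hTpos d hdT).ne']
  have hmemT : ∀ k, 1 ≤ k → g.coeff k ≠ 0 → k ∈ T := fun k hk hk' =>
    Finset.mem_filter.2 ⟨Finset.mem_Icc.2 ⟨hk, le_natDegree_of_ne_zero hk'⟩, hk'⟩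
  refine ⟨s, ?_, ?_⟩
  · obtain ⟨H, hH⟩ := exists_isReduction (g := g) (s := s) (e := -v 0) (by
      intro k
      rcases Nat.eq_zero_or_pos k with rfl | hk
      · simpa using (hv 0 h0).1
      by_cases hk' : g.coeff k = 0
      · rw [hk']; exact zero_mem _
      refine valGe_mono ?_ (hv k hk').1
      have := hvs k (hmemT k hk hk')
      linarith)
    refine ⟨_, H, hH, ?_⟩
    have hdT' := Finset.mem_filter.1 hdT
    refine (Finset.mem_Icc.1 hdT'.1).1.trans (le_natDegree_of_ne_zero ?_)
    rw [hH.coeff_map_red]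
    convert (hv d hdT'.2).2 using 2
    linarith
  · intro s' e' H' hH' hd'
    set k := (H'.map (red p)).natDegree with hk
    have hk0 : (H'.map (red p)).coeff k ≠ 0 := by
      rw [hk, coeff_natDegree, Ne, leadingCoeff_eq_zero]
      intro h
      rw [h, natDegree_zero] at hk
      omega
    rw [hH'.coeff_map_red] at hk0
    have hgk : g.coeff k ≠ 0 := by
      intro h
      rw [h, coeffAt_zero] at hk0
      exact hk0 rfl
    have h1 := le_of_mem_valGe (hv k hgk).1 hk0
    have h2 := le_of_mem_valGe (hH'.coeff_mem 0) (hv 0 h0).2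
    have h3 := hvs k (hmemT k hd' hgk)
    have hkpos := hTpos k (hmemT k hd' hgk)
    simp only [Nat.cast_zero, zero_mul, add_zero] at h2
    refine ⟨le_of_mul_le_mul_left (by linarith) hkpos, fun hz => ?_⟩
    -- A vanishing reduced constant term means that `(0, v 0)` lies strictly above the supporting
    -- line of slope `s'`, so the chord to degree `k` is strictly steeper.
    have h4 : -e' ≠ v 0 := by
      intro h
      rw [hH'.coeff_map_red] at hz
      simp only [Nat.cast_zero, zero_mul, add_zero, h] at hz
      exact (hv 0 h0).2 hz
    have h5 := lt_of_le_of_ne h2 h4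
    exact lt_of_mul_lt_mul_left (by linarith) hkpos.le

/-- Suppose there is no root. A pair `(r, s)` in `P` is a ball on which `f` has a nonconstant
reduction. Zorn's lemma applies by spherical completeness. At a maximal ball, translating by a root
of the reduction kills the reduced constant term, which forces a strictly larger slope at the new
centre. -/
theorem exists_root_of_one_le_natDegree (f : (MalcevNeumann p)[X]) (hf : 1 ≤ f.natDegree) :
    ∃ r, f.eval r = 0 := by
  by_contra! hroot
  let P : Set (MalcevNeumann p × ℚ) := {a | ∃ e H, IsReduction (f.comp (X + C a.1)) a.2 e H ∧
    1 ≤ (H.map (red p)).natDegree}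
  let le : P → P → Prop := fun a b => a.1.2 ≤ b.1.2 ∧ b.1.1 - a.1.1 ∈ valGe p a.1.2
  have hshift : ∀ r r' s e H, IsReduction (f.comp (X + C r)) s e H → r' - r ∈ valGe p s →
      ∃ u : integers p, (u : MalcevNeumann p) * ppow p s = r' - r ∧
        IsReduction (f.comp (X + C r')) s e (H.comp (X + C u)) := by
    intro r r' s e H h hr
    have hu : (r' - r) * ppow p (-s) ∈ integers p := mul_ppow_mem_valGe.2 (by simpa using hr)
    have hu' : (r' - r) * ppow p (-s) * ppow p s = r' - r := by
      rw [mul_assoc, mul_comm (ppow p (-s)), ppow_mul_ppow_neg, mul_one]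
    refine ⟨⟨_, hu⟩, hu', ?_⟩
    have := h.comp_X_add_C ⟨_, hu⟩
    rw [comp_assoc] at this
    rw [Polynomial.add_comp, Polynomial.X_comp, Polynomial.C_comp, add_assoc, ← C_add] at this
    change IsReduction (f.comp (X + C ((r' - r) * ppow p (-s) * ppow p s + r))) s e _ at this
    rwa [hu', sub_add_cancel] at this
  have hslope : ∀ r, ∃ s, (r, s) ∈ P ∧
      ∀ s' e' H', IsReduction (f.comp (X + C r)) s' e' H' → 1 ≤ (H'.map (red p)).natDegree →
        s' ≤ s ∧ ((H'.map (red p)).coeff 0 = 0 → s' < s) := by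
    intro r
    refine exists_max_slope (g := f.comp (X + C r)) ?_ ?_
    · rw [coeff_zero_eq_eval_zero, eval_comp]
      simpa using hroot r
    · rwa [natDegree_comp, natDegree_X_add_C, mul_one]
  obtain ⟨s₀, hs₀, -⟩ := hslope 0
  have : Nonempty P := ⟨⟨_, hs₀⟩⟩
  obtain ⟨⟨⟨r, s⟩, e, H, hH, hd⟩, hm⟩ := exists_maximal_of_nonempty_chains_bounded (r := le)
    (by
      intro c hc hne
      obtain ⟨r, hr⟩ := exists_mem_balls (Subtype.val '' c) (by
        rintro _ ⟨a, ha, rfl⟩ _ ⟨b, hb, rfl⟩ hab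
        rcases eq_or_ne a b with rfl | hne
        · simp [zero_mem]
        rcases hc ha hb hne with h | h
        · exact h.2
        · have h2 : b.1.2 = a.1.2 := le_antisymm h.1 hab
          rw [← h2, ← neg_sub]
          exact neg_mem h.2)
      -- The common point `r` of the balls is not a root, so its own largest slope exists; it bounds
      -- every slope in the chain, since each reduction can be recentred at `r`.
      obtain ⟨s, hs, hmax⟩ := hslope r
      refine ⟨⟨(r, s), hs⟩, fun a ha => ?_⟩
      have h1 := hr a.1 ⟨a, ha, rfl⟩
      obtain ⟨e, H, hH, hd⟩ := a.2
      obtain ⟨u, -, hu⟩ := hshift _ _ _ _ _ hH h1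
      exact ⟨(hmax _ _ _ hu (by rwa [natDegree_map_red_comp])).1, h1⟩)
    (by
      intro a b c hab hbc
      refine ⟨hab.1.trans hbc.1, ?_⟩
      have := add_mem (valGe_mono hab.1 hbc.2) hab.2
      rwa [sub_add_sub_cancel] at this)
  obtain ⟨c, hc⟩ := IsAlgClosed.exists_root (H.map (red p)) (by
    intro h
    rw [natDegree_eq_zero_iff_degree_le_zero.2 h.le] at hd
    omega)
  have hH' := hH.comp_X_add_C ⟨teich p c, teich_mem_integers c⟩
  rw [comp_assoc] at hH'
  rw [Polynomial.add_comp, Polynomial.X_comp, Polynomial.C_comp, add_assoc, ← C_add] at hH'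
  obtain ⟨s', hs', hmax⟩ := hslope (teich p c * ppow p s + r)
  have hlt := (hmax _ _ _ hH' (by rwa [natDegree_map_red_comp])).2 (by
    rw [Polynomial.map_comp, coeff_zero_eq_eval_zero, eval_comp]
    have : red p ⟨teich p c, teich_mem_integers c⟩ = c := coeffAt_zero_teich c
    simpa [this] using hc)
  have := (hm ⟨_, hs'⟩ ⟨hlt.le, by
    simpa using mul_ppow_mem_valGe.2 (by simpa using mem_integers.1 (teich_mem_integers c))⟩).1
  exact absurd hlt (not_lt.2 this)

instance : IsAlgClosed (MalcevNeumann p) :=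
  IsAlgClosed.of_exists_root _ fun f _ hf => exists_root_of_one_le_natDegree f hf.natDegree_pos

end MalcevNeumann

namespace MalcevNeumann

variable {p : ℕ} [hp : Fact p.Prime]

open Polynomial

/-! ### The Newton polygon and the residue polynomial from a reduction -/

theorem coeffAt_ne_zero_of_val_le {A : MalcevNeumann p} {x : ℚ} (hA : A ∈ valGe p x)
    (h : val A ≤ x) : coeffAt x A ≠ 0 := by
  have h0 : A ≠ 0 := by
    rintro rfl
    have := le_of_val_le (x := x + 1) (zero_mem _) h
    linarith
  obtain ⟨y, hy, hc⟩ := exists_leading h0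
  have h1 := le_of_val_le hy h
  rwa [le_antisymm (le_of_mem_valGe hA hc) h1]

section NewtonPolygon

variable {P : (MalcevNeumann p)[X]} {s e : ℚ} {H : (integers p)[X]}

/-- The first condition is a half-plane over the line of slope `s` through `(N, -e)`, `N` the
degree. The second says that the region meets this line only at abscissas `≥ N - d`, `d` the degree
of the reduction. Together they cut out a convex set, so checking the defining points suffices. -/
theorem newtonRegion_subset (h : IsReduction P s e H) {w : ℚ × ℚ} (hw : w ∈ newtonRegion P) :
    0 ≤ w.2 + e + (P.natDegree - w.1) * s ∧ (w.2 + e + (P.natDegree - w.1) * s = 0 →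
      (P.natDegree : ℚ) - (H.map (red p)).natDegree ≤ w.1) := by
  let S : Set (ℚ × ℚ) := {w | 0 ≤ w.2 + e + (P.natDegree - w.1) * s ∧
    (w.2 + e + (P.natDegree - w.1) * s = 0 →
      (P.natDegree : ℚ) - (H.map (red p)).natDegree ≤ w.1)}
  suffices newtonRegion P ⊆ S from this hw
  refine convexHull_min ?_ ?_
  · rintro ⟨x, y⟩ ⟨i, hi, hx, hy⟩
    simp only at hx hy
    subst hx
    have hcast : ((P.natDegree - i : ℕ) : ℚ) = P.natDegree - i := by push_cast [hi]; ring
    have h1 := h.coeff_mem (P.natDegree - i)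
    have h2 := le_of_val_le h1 hy
    rw [hcast] at h1 h2
    refine ⟨by simp only; linarith, fun h3 => ?_⟩
    simp only at h3 ⊢
    have h4 : y = -(e + (P.natDegree - i) * s) := by linarith
    rw [h4] at hy
    have h5 := coeffAt_ne_zero_of_val_le h1 hy
    rw [← hcast, ← h.coeff_map_red] at h5
    have h6 : ((P.natDegree - i : ℕ) : ℚ) ≤ (H.map (red p)).natDegree := by
      exact_mod_cast le_natDegree_of_ne_zero h5
    rw [hcast] at h6
    linarith
  · rw [convex_iff_forall_pos]
    rintro ⟨x₁, y₁⟩ ⟨h1, h1'⟩ ⟨x₂, y₂⟩ ⟨h2, h2'⟩ a b ha hb hab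
    simp only at h1 h1' h2 h2'
    have key : (a * y₁ + b * y₂) + e + (P.natDegree - (a * x₁ + b * x₂)) * s
        = a * (y₁ + e + (P.natDegree - x₁) * s) + b * (y₂ + e + (P.natDegree - x₂) * s) := by
      linear_combination (-(e + P.natDegree * s)) * hab
    have p1 := mul_nonneg ha.le h1
    have p2 := mul_nonneg hb.le h2
    refine ⟨?_, fun h3 => ?_⟩
    · simp only [Prod.smul_mk, Prod.mk_add_mk, smul_eq_mul]
      rw [key]
      exact add_nonneg p1 p2
    · simp only [Prod.smul_mk, Prod.mk_add_mk, smul_eq_mul] at h3 ⊢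
      rw [key] at h3
      have q1 := h1' ((mul_eq_zero.1 (le_antisymm (by linarith) p1)).resolve_left ha.ne')
      have q2 := h2' ((mul_eq_zero.1 (le_antisymm (by linarith) p2)).resolve_left hb.ne')
      calc (P.natDegree : ℚ) - (H.map (red p)).natDegree
          = a * (P.natDegree - (H.map (red p)).natDegree)
            + b * (P.natDegree - (H.map (red p)).natDegree) := by rw [← add_mul, hab, one_mul]
        _ ≤ a * x₁ + b * x₂ := by gcongr

theorem mem_newtonRegion {i : ℕ} (hi : i ≤ P.natDegree) {y : ℚ}
    (hy : val (P.coeff (P.natDegree - i)) ≤ y) : ((i : ℚ), y) ∈ newtonRegion P :=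
  subset_convexHull ℚ _ ⟨i, hi, rfl, hy⟩

theorem IsReduction.natDegree_le (h : IsReduction P s e H)
    (hd : (H.map (red p)).natDegree ≠ 0) : (H.map (red p)).natDegree ≤ P.natDegree := by
  refine le_natDegree_of_ne_zero fun h0 => ?_
  have h1 := h.coeff_map_red (H.map (red p)).natDegree
  rw [h0, coeffAt_zero, coeff_natDegree, Polynomial.leadingCoeff_eq_zero] at h1
  rw [h1] at hd
  exact hd natDegree_zero

theorem IsReduction.val_coeff (h : IsReduction P s e H) {k : ℕ}
    (hk : (H.map (red p)).coeff k ≠ 0) :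
    P.coeff k ∈ valGe p (-(e + k * s)) ∧ coeffAt (-(e + k * s)) (P.coeff k) ≠ 0 :=
  ⟨h.coeff_mem k, by rwa [← h.coeff_map_red]⟩

/-- The reduction has nonzero coefficients in degrees `0` and `d`, so the points at `N` and `N - d`
lie on the supporting line. Since the region meets the line only from `N - d` onwards, the left
point is extreme; nothing strictly between is. -/
theorem IsReduction.maxBreakpoint_eq (h : IsReduction P s e H)
    (hd : (H.map (red p)).natDegree ≠ 0) (h0 : (H.map (red p)).coeff 0 ≠ 0) :
    maxBreakpoint P = P.natDegree - (H.map (red p)).natDegree := by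
  have hle := h.natDegree_le hd
  have hlead : (H.map (red p)).coeff (H.map (red p)).natDegree ≠ 0 := by
    rw [coeff_natDegree, Ne, Polynomial.leadingCoeff_eq_zero]
    intro h1
    rw [h1] at hd
    exact hd natDegree_zero
  have hsub := fun w (hw : w ∈ newtonRegion P) => newtonRegion_subset h hw
  set d := (H.map (red p)).natDegree with hd'
  have hvd := h.val_coeff hlead
  have hv0 := h.val_coeff h0
  have hcast : ((P.natDegree - d : ℕ) : ℚ) = P.natDegree - d := by push_cast [hle]; ring
  have hNd : P.natDegree - (P.natDegree - d) = d := by omega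
  have hmem : (((P.natDegree - d : ℕ) : ℚ), -(e + d * s)) ∈ newtonRegion P :=
    mem_newtonRegion (by omega) (by rw [hNd, val_eq hvd.1 hvd.2])
  refine IsGreatest.csSup_eq ⟨⟨by omega, by omega, -(e + d * s), ?_, ?_⟩, ?_⟩
  · rw [hNd, val_eq hvd.1 hvd.2]
  · refine ⟨hmem, ?_⟩
    rintro ⟨x₁, y₁⟩ h1 ⟨x₂, y₂⟩ h2 ⟨a, b, ha, hb, hab, hs⟩
    obtain ⟨g1, f1⟩ := hsub _ h1
    obtain ⟨g2, f2⟩ := hsub _ h2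
    simp only [Prod.smul_mk, Prod.mk_add_mk, smul_eq_mul, Prod.mk.injEq, hcast] at hs g1 f1 g2 f2 ⊢
    obtain ⟨hs1, hs2⟩ := hs
    have p1 := mul_nonneg ha.le g1
    have p2 := mul_nonneg hb.le g2
    have key : a * (y₁ + e + (P.natDegree - x₁) * s) + b * (y₂ + e + (P.natDegree - x₂) * s)
        = 0 := by
      linear_combination (e + P.natDegree * s) * hab + hs2 - s * hs1
    have q1 := (mul_eq_zero.1 (le_antisymm (by linarith) p1)).resolve_left ha.ne'
    have q2 := (mul_eq_zero.1 (le_antisymm (by linarith) p2)).resolve_left hb.ne'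
    have r1 := f1 q1
    have r2 := mul_nonneg hb.le (sub_nonneg.2 (f2 q2))
    have r3 : a * (x₁ - (P.natDegree - d)) + b * (x₂ - (P.natDegree - d)) = 0 := by
      linear_combination hs1 - (P.natDegree - (d : ℚ)) * hab
    have r4 := (mul_eq_zero.1 (le_antisymm (by linarith) (mul_nonneg ha.le
      (sub_nonneg.2 r1)))).resolve_left ha.ne'
    have hx : x₁ = P.natDegree - d := by linarith
    refine ⟨hx, ?_⟩
    rw [hx] at q1
    linarith
  · rintro i ⟨hi, -, y, hy, -, hext⟩
    by_contra hlt
    rw [not_le] at hlt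
    have hiy := mem_newtonRegion hi.le hy.le
    have hg := (hsub _ hiy).1
    simp only at hg
    have hmem0 : ((P.natDegree : ℚ), -e) ∈ newtonRegion P := by
      refine mem_newtonRegion le_rfl ?_
      rw [Nat.sub_self, val_eq hv0.1 hv0.2]
      simp
    have hltq : (P.natDegree : ℚ) - d < i := by rw [← hcast]; exact_mod_cast hlt
    have hiq : (i : ℚ) < P.natDegree := by exact_mod_cast hi
    have hdpos : (0 : ℚ) < d := by linarith
    have hseg : ((i : ℚ), -(e + (P.natDegree - i) * s)) ∈
        openSegment ℚ (((P.natDegree - d : ℕ) : ℚ), -(e + d * s)) ((P.natDegree : ℚ), -e) := by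
      refine ⟨(P.natDegree - i) / d, (i - (P.natDegree - d)) / d, div_pos (by linarith) hdpos,
        div_pos (by linarith) hdpos, ?_, ?_⟩
      · field_simp; ring
      · rw [hcast]
        simp only [Prod.smul_mk, Prod.mk_add_mk, smul_eq_mul, Prod.mk.injEq]
        constructor <;> field_simp <;> ring
    -- A point on the line is interior to the edge. A point above it is the midpoint of its
    -- projection to the line and the reflection of that projection, and both lie in the region.
    rcases eq_or_lt_of_le hg with hg0 | hgpos
    · have : y = -(e + (P.natDegree - i) * s) := by linarith
      rw [← this] at hseg
      have := congrArg Prod.fst (hext hmem hmem0 hseg)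
      simp only [hcast] at this
      linarith
    · have hline : ((i : ℚ), -(e + (P.natDegree - i) * s)) ∈ newtonRegion P :=
        (convex_convexHull ℚ _).openSegment_subset hmem hmem0 hseg
      have hup : ((i : ℚ), 2 * y + (e + (P.natDegree - i) * s)) ∈ newtonRegion P := by
        refine mem_newtonRegion hi.le ?_
        rw [hy]
        exact WithTop.coe_le_coe.2 (by linarith)
      have := congrArg Prod.snd (hext hline hup ⟨1 / 2, 1 / 2, by norm_num, by norm_num,
        by norm_num, by
          simp only [Prod.smul_mk, Prod.mk_add_mk, smul_eq_mul, Prod.mk.injEq]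
          constructor <;> ring⟩)
      simp only at this
      linarith

theorem IsReduction.maxSlope_eq (h : IsReduction P s e H)
    (hd : (H.map (red p)).natDegree ≠ 0) (h0 : (H.map (red p)).coeff 0 ≠ 0) :
    maxSlope P = s := by
  have hle := h.natDegree_le hd
  have hlead : (H.map (red p)).coeff (H.map (red p)).natDegree ≠ 0 := by
    rw [coeff_natDegree, Ne, Polynomial.leadingCoeff_eq_zero]
    intro h1
    rw [h1] at hd
    exact hd natDegree_zero
  rw [maxSlope, h.maxBreakpoint_eq hd h0, Nat.sub_sub_self hle,
    valRat_eq (h.val_coeff h0).1 (h.val_coeff h0).2,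
    valRat_eq (h.val_coeff hlead).1 (h.val_coeff hlead).2]
  have : ((H.map (red p)).natDegree : ℚ) ≠ 0 := by exact_mod_cast hd
  push_cast [hle]
  rw [sub_sub_cancel, div_eq_iff this]
  ring

theorem IsReduction.residuePoly_eq (h : IsReduction P s e H)
    (hd : (H.map (red p)).natDegree ≠ 0) (h0 : (H.map (red p)).coeff 0 ≠ 0) :
    residuePoly P = H.map (red p) := by
  have hle := h.natDegree_le hd
  have hlead : (H.map (red p)).coeff (H.map (red p)).natDegree ≠ 0 := by
    rw [coeff_natDegree, Ne, Polynomial.leadingCoeff_eq_zero]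
    intro h1
    rw [h1] at hd
    exact hd natDegree_zero
  rw [residuePoly, h.maxSlope_eq hd h0, h.maxBreakpoint_eq hd h0, Nat.sub_sub_self hle,
    valRat_eq (h.val_coeff hlead).1 (h.val_coeff hlead).2]
  conv_rhs => rw [as_sum_range (H.map (red p))]
  refine Finset.sum_congr rfl fun k _ => ?_
  rw [coeffAt_mul_ppow, h.coeff_map_red]
  congr 2
  push_cast [hle]
  ring

end NewtonPolygon

/-! ### Reductions of split polynomials -/

theorem IsReduction.mul {g g' : (MalcevNeumann p)[X]} {s e e' : ℚ} {H H' : (integers p)[X]}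
    (h : IsReduction g s e H) (h' : IsReduction g' s e' H') :
    IsReduction (g * g') s (e + e') (H * H') := by
  rw [isReduction_iff] at *
  rw [Polynomial.map_mul, h, h', ppow_add, C_mul, mul_comp]
  ring

/-- A root of valuation below `s` reduces to a nonzero constant; only valuation exactly `s` leaves a
linear factor. -/
theorem exists_isReduction_X_sub_C {A : MalcevNeumann p} {v s : ℚ} (hA : A ∈ valGe p v)
    (hvs : v ≤ s) : ∃ H, IsReduction (X - C A) s (-v) H ∧
      H.map (red p) = if v = s then X - C (coeffAt v A) else -C (coeffAt v A) := by
  have h0 : (X - C A).coeff 0 = -A := by simp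
  have h1 : (X - C A).coeff 1 = 1 := by simp
  have h2 : ∀ k, (X - C A).coeff (k + 2) = 0 := fun k => by simp [coeff_X]
  obtain ⟨H, hH⟩ := exists_isReduction (g := X - C A) (s := s) (e := -v) (by
    rintro (_ | _ | k)
    · rw [h0]
      simpa using hA
    · rw [zero_add, h1]
      refine valGe_mono ?_ one_mem_valGe
      push_cast
      linarith
    · rw [h2]
      exact zero_mem _)
  refine ⟨H, hH, ?_⟩
  ext k
  rw [hH.coeff_map_red]
  rcases k with _ | _ | k
  · rw [h0]
    have : -(-v + ((0 : ℕ) : ℚ) * s) = v := by simp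
    rw [this, coeffAt_neg hA (by linarith)]
    split_ifs <;> simp
  · rw [zero_add, h1, coeffAt_one]
    by_cases h : v = s
    · simp [h]
    · have : -(-v + ((1 : ℕ) : ℚ) * s) ≠ 0 := fun h' => h (by push_cast at h'; linarith)
      rw [if_neg this, if_neg h]
      simp
  · rw [h2, coeffAt_zero]
    split_ifs <;> simp [coeff_X]

/-- Reductions multiply, so the roots of the product's reduction are the leading coefficients of the
`f i` of valuation `s`, all nonzero. -/
theorem exists_isReduction_prod {ι : Type*} (S : Finset ι) (f : ι → MalcevNeumann p) (s : ℚ)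
    (hf : ∀ i ∈ S, ∃ v ≤ s, f i ∈ valGe p v ∧ coeffAt v (f i) ≠ 0) :
    ∃ e H, IsReduction (∏ i ∈ S, (X - C (f i))) s e H ∧ H.map (red p) ≠ 0 ∧
      (∀ c, (H.map (red p)).IsRoot c ↔ ∃ i ∈ S, f i ∈ valGe p s ∧ coeffAt s (f i) = c) ∧
      (H.map (red p)).coeff 0 ≠ 0 := by
  classical
  induction S using Finset.induction_on with
  | empty =>
    refine ⟨0, 1, ?_, ?_, ?_, ?_⟩
    · rw [isReduction_iff]
      simp [ppow_zero]
    · simp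
    · simp
    · simp
  | insert i S hi ih =>
    obtain ⟨e, H, hH, hne, hroot, h0⟩ := ih fun j hj => hf j (Finset.mem_insert_of_mem hj)
    obtain ⟨v, hvs, hv, hc⟩ := hf i (Finset.mem_insert_self i S)
    obtain ⟨H₁, hH₁, hred⟩ := exists_isReduction_X_sub_C hv hvs
    have hne₁ : H₁.map (red p) ≠ 0 := by
      rw [hred]
      split_ifs
      · exact X_sub_C_ne_zero _
      · rwa [Ne, neg_eq_zero, C_eq_zero]
    refine ⟨-v + e, H₁ * H, ?_, ?_, ?_, ?_⟩
    · rw [Finset.prod_insert hi]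
      exact hH₁.mul hH
    · rw [Polynomial.map_mul]
      exact mul_ne_zero hne₁ hne
    · intro c
      rw [Polynomial.map_mul, IsRoot, eval_mul, mul_eq_zero]
      change _ ∨ (H.map (red p)).IsRoot c ↔ _
      rw [hroot, Finset.exists_mem_insert]
      refine or_congr ?_ Iff.rfl
      rw [hred]
      split_ifs with h
      · subst h
        simp only [eval_sub, eval_X, eval_C, sub_eq_zero, hv, true_and]
        exact eq_comm
      · simp only [eval_neg, eval_C, neg_eq_zero, hc, false_iff, not_and]
        intro h' _
        exact h (le_antisymm hvs (le_of_mem_valGe h' hc))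
    · rw [Polynomial.map_mul, mul_coeff_zero]
      refine mul_ne_zero ?_ h0
      rw [hred]
      split_ifs <;> simpa using hc

/-- One step of the Newton algorithm for a product of distinct linear factors: the largest slope
is the largest valuation of a root, and the roots of the residue polynomial are the leading
coefficients of the roots with that valuation. -/
theorem newton_step {ι : Type*} (S : Finset ι) (f : ι → MalcevNeumann p) (s : ℚ)
    (hf : ∀ i ∈ S, ∃ v ≤ s, f i ∈ valGe p v ∧ coeffAt v (f i) ≠ 0)
    (hs : ∃ i ∈ S, f i ∈ valGe p s) :
    (∏ i ∈ S, (X - C (f i))).coeff 0 ≠ 0 ∧ maxSlope (∏ i ∈ S, (X - C (f i))) = s ∧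
      ∀ c, (residuePoly (∏ i ∈ S, (X - C (f i)))).IsRoot c ↔
        ∃ i ∈ S, f i ∈ valGe p s ∧ coeffAt s (f i) = c := by
  obtain ⟨e, H, hH, hne, hroot, h0⟩ := exists_isReduction_prod S f s hf
  obtain ⟨i, hi, his⟩ := hs
  have hd : (H.map (red p)).natDegree ≠ 0 := by
    intro hd
    have hr := (hroot (coeffAt s (f i))).2 ⟨i, hi, his, rfl⟩
    rw [natDegree_eq_zero] at hd
    obtain ⟨a, ha⟩ := hd
    rw [← ha, IsRoot, eval_C] at hr
    rw [← ha, hr, C_0] at hne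
    exact hne rfl
  refine ⟨fun h => h0 ?_, hH.maxSlope_eq hd h0, ?_⟩
  · rw [hH.coeff_map_red, h, coeffAt_zero]
  · rw [hH.residuePoly_eq hd h0]
    exact hroot

end MalcevNeumann

/-- The first-order expansion of `(x + y) ^ p` in `y`, up to multiples of `p`. -/
theorem exists_add_pow_prime_first_order {R : Type*} [CommRing R] {p : ℕ} (hp : p.Prime)
    (x y : R) : ∃ r, (x + y) ^ p = x ^ p + y ^ p + p * (x ^ (p - 1) * y) + p * (y ^ 2 * r) := by
  have hp2 := hp.two_le
  refine ⟨∑ k ∈ Finset.Ioo 1 p, y ^ (k - 2) * x ^ (p - k) * ↑(p.choose k / p), ?_⟩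
  rw [add_comm x y, add_pow_prime_eq' hp]
  have : Finset.Ioo 0 p = insert 1 (Finset.Ioo 1 p) := by
    ext k
    simp only [Finset.mem_Ioo, Finset.mem_insert]
    omega
  rw [this, Finset.sum_insert (by simp), Nat.choose_one_right, Nat.div_self hp.pos, mul_add,
    Finset.mul_sum (s := Finset.Ioo 1 p) (a := y ^ 2)]
  have h2 : ∀ k ∈ Finset.Ioo 1 p, y ^ k * x ^ (p - k) * ((p.choose k / p : ℕ) : R)
      = y ^ 2 * (y ^ (k - 2) * x ^ (p - k) * ((p.choose k / p : ℕ) : R)) := by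
    intro k hk
    have : k = 2 + (k - 2) := by have := Finset.mem_Ioo.1 hk; omega
    conv_lhs => rw [this, pow_add]
    rw [← this]
    ring
  rw [Finset.sum_congr rfl h2]
  push_cast
  ring

/-! ### Leading terms of roots of unity. -/

namespace MalcevNeumann

variable {p : ℕ} [hp : Fact p.Prime]

open Polynomial

theorem exists_add_pow_prime {A B : MalcevNeumann p} (hA : A ∈ valGe p 0) (hB : B ∈ valGe p 0) :
    ∃ r ∈ valGe p 0,
      (A + B) ^ p = A ^ p + B ^ p + p * (A ^ (p - 1) * B) + p * (B ^ 2 * r) := by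
  obtain ⟨r, hr⟩ := exists_add_pow_prime_first_order hp.out
    (⟨A, hA⟩ : integers p) (⟨B, hB⟩ : integers p)
  exact ⟨r, r.2, by simpa using congrArg (integers p).subtype hr⟩

theorem pow_prime_injective : Function.Injective fun c : Fpbar p => c ^ p :=
  frobenius_inj (Fpbar p) p

/-- The exponent `1 / (p^N (p-1))`, the valuation of `ζ - 1` for `ζ` of order `p^(N+1)`. -/
noncomputable def rootExp (p N : ℕ) : ℚ := 1 / ((p : ℚ) ^ N * ((p : ℚ) - 1))

section rootExp

variable (p)

theorem one_lt_prime_cast : (1 : ℚ) < p := by exact_mod_cast hp.out.one_lt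

theorem rootExp_pos (N : ℕ) : 0 < rootExp p N := by
  have := one_lt_prime_cast p
  exact div_pos one_pos (mul_pos (by positivity) (by linarith))

theorem prime_mul_rootExp_succ (N : ℕ) : p * rootExp p (N + 1) = rootExp p N := by
  have := one_lt_prime_cast p
  have h1 : (p : ℚ) - 1 ≠ 0 := by linarith
  rw [rootExp, rootExp, pow_succ']
  field_simp

theorem prime_sub_one_mul_rootExp_zero : ((p : ℚ) - 1) * rootExp p 0 = 1 := by
  have := one_lt_prime_cast p
  have h1 : (p : ℚ) - 1 ≠ 0 := by linarith
  rw [rootExp]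
  field_simp

theorem rootExp_zero_sub : rootExp p 0 - rootExp p 1 = 1 / p := by
  have := one_lt_prime_cast p
  have h1 : (p : ℚ) - 1 ≠ 0 := by linarith
  rw [rootExp, rootExp]
  field_simp

theorem rootExp_succ_le (N : ℕ) : rootExp p (N + 1) ≤ rootExp p N := by
  have := one_lt_prime_cast p
  rw [← prime_mul_rootExp_succ p N]
  nlinarith [rootExp_pos p (N + 1)]

theorem rootExp_lt_one (h3 : 3 ≤ p) (N : ℕ) : rootExp p N < 1 := by
  induction N with
  | zero =>
    have h1 : (3 : ℚ) ≤ p := by exact_mod_cast h3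
    nlinarith [prime_sub_one_mul_rootExp_zero p, rootExp_pos p 0]
  | succ N ih => exact (rootExp_succ_le p N).trans_lt ih

end rootExp

theorem mem_valGe_zero_of_pow_eq_one {A : MalcevNeumann p} {k : ℕ} (hk : k ≠ 0)
    (h : A ^ k = 1) : A ∈ valGe p 0 :=
  mem_valGe_of_pow hk (by rw [h, mul_zero]; exact one_mem_valGe)

theorem coeffAt_pow_prime {A : MalcevNeumann p} (hA : A ∈ valGe p 0) {x : ℚ} (hx : p * x < 1) :
    coeffAt (p * x) (A ^ p) = coeffAt x A ^ p :=
  coeffAt_prime_mul_pow hA (by linarith)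

/-- The leading terms of a root of unity of order `p^(N+1)`. -/
theorem leading_of_isPrimitiveRoot (h3 : 3 ≤ p) {N : ℕ} {ζ : MalcevNeumann p}
    (hζ : IsPrimitiveRoot ζ (p ^ (N + 1))) :
    ζ ∈ valGe p 0 ∧ coeffAt 0 ζ = 1 ∧ ζ - 1 ∈ valGe p (rootExp p N) ∧
      coeffAt (rootExp p N) ζ ^ (p - 1) = -1 := by
  have hpne := hp.out.ne_zero
  have hppos : (0 : ℚ) < p := by have := one_lt_prime_cast p; linarith
  induction N generalizing ζ with
  | zero =>
    rw [zero_add, pow_one] at hζ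
    have hint := mem_valGe_zero_of_pow_eq_one hpne hζ.pow_eq_one
    have hC0 : coeffAt 0 ζ = 1 := by
      apply pow_prime_injective
      simp only [one_pow]
      rw [← coeffAt_zero_pow hint, hζ.pow_eq_one, coeffAt_one, if_pos rfl]
    have hpi : ζ - 1 ∈ valGe p 0 := sub_mem hint one_mem_valGe
    have hpi0 : ζ - 1 ≠ 0 := sub_ne_zero.2 (hζ.ne_one hp.out.one_lt)
    have hpiC : ∀ x < 1, coeffAt x (ζ - 1) = coeffAt x ζ - coeffAt x 1 := fun x hx =>
      coeffAt_sub hint one_mem_valGe (by linarith)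
    obtain ⟨r, hr, hexp⟩ := exists_add_pow_prime one_mem_valGe hpi
    rw [add_sub_cancel, hζ.pow_eq_one, one_pow, one_pow, one_mul] at hexp
    -- Expand `(1 + π)^p = 1` with `π = ζ - 1` and divide by `π`; the leading terms of both sides
    -- give valuation `1/(p-1)` and `c^(p-1) = -1`.
    have heq : (ζ - 1) ^ (p - 1) = -(p * (1 + (ζ - 1) * r)) := by
      apply mul_right_cancel₀ hpi0
      rw [← pow_succ, Nat.sub_add_cancel hp.out.one_le]
      linear_combination -hexp
    obtain ⟨y, hy, hyC⟩ := exists_leading hpi0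
    have hy0 : 0 < y := by
      refine lt_of_le_of_ne (le_of_mem_valGe hpi hyC) ?_
      rintro rfl
      rw [hpiC 0 one_pos, hC0, coeffAt_one, if_pos rfl, sub_self] at hyC
      exact hyC rfl
    have hmul := mul_mem_valGe hy hr
    have hu : 1 + (ζ - 1) * r ∈ valGe p 0 :=
      add_mem one_mem_valGe (valGe_mono (by linarith) hmul)
    have huC : coeffAt 0 (1 + (ζ - 1) * r) = 1 := by
      rw [coeffAt_add one_mem_valGe (valGe_mono (by linarith) hmul) (by norm_num), coeffAt_one,
        if_pos rfl, hmul 0 (by linarith), add_zero]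
    have hR : -((p : MalcevNeumann p) * (1 + (ζ - 1) * r)) ∈ valGe p 1 :=
      neg_mem (prime_mul_mem_valGe.2 (by simpa using hu))
    have hRC : coeffAt 1 (-((p : MalcevNeumann p) * (1 + (ζ - 1) * r))) = -1 := by
      rw [coeffAt_neg (prime_mul_mem_valGe.2 (by simpa using hu) : _ ∈ valGe p 1) (by norm_num),
        coeffAt_prime_mul, sub_self, huC]
    have hL := pow_mem_valGe hy (p - 1)
    have hLC := coeffAt_mul_pow hy (p - 1)
    have hcast : ((p - 1 : ℕ) : ℚ) = p - 1 := by push_cast [hp.out.one_le]; ring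
    rw [heq, hcast] at hL hLC
    have hle1 := le_of_mem_valGe hL (by rw [hRC]; exact neg_ne_zero.2 one_ne_zero)
    have hle2 := le_of_mem_valGe hR (by rw [hLC]; exact pow_ne_zero _ hyC)
    have hyeq : y = rootExp p 0 := by
      have h1 := prime_sub_one_mul_rootExp_zero p
      have h2 := one_lt_prime_cast p
      exact mul_left_cancel₀ (sub_ne_zero.2 h2.ne') (by linarith)
    have hy1 : ((p : ℚ) - 1) * y = 1 := by linarith
    rw [hy1, hRC, hpiC y (by rw [hyeq]; exact rootExp_lt_one p h3 0), coeffAt_one, if_neg hy0.ne',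
      sub_zero, hyeq] at hLC
    rw [hyeq] at hy
    exact ⟨hint, hC0, hy, hLC.symm⟩
  | succ N ih =>
    -- Everything is pulled back from `ζ ^ p` through Frobenius; as `p` is odd, `-1` is its own
    -- `p`-th power.
    have hζp : IsPrimitiveRoot (ζ ^ p) (p ^ (N + 1)) :=
      hζ.pow (pow_pos hp.out.pos _) (by ring)
    obtain ⟨hint', hC0', hpi', hC'⟩ := ih hζp
    have hint := mem_valGe_zero_of_pow_eq_one (pow_ne_zero _ hpne) hζ.pow_eq_one
    have hC0 : coeffAt 0 ζ = 1 := by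
      apply pow_prime_injective
      simp only [one_pow]
      rw [← coeffAt_zero_pow hint, hC0']
    have hlt := rootExp_lt_one p h3 N
    have hlt' := rootExp_lt_one p h3 (N + 1)
    have hsucc := prime_mul_rootExp_succ p N
    refine ⟨hint, hC0, fun x hx => ?_, ?_⟩
    · rw [coeffAt_sub hint one_mem_valGe (by linarith), coeffAt_one]
      have hpx : p * x < rootExp p N := by rw [← hsucc]; gcongr
      split_ifs with h0
      · rw [h0, hC0, sub_self]
      · rw [sub_zero]
        apply pow_prime_injective
        simp only [zero_pow hpne]
        rw [← coeffAt_pow_prime hint (by linarith)]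
        have := hpi' _ hpx
        rwa [coeffAt_sub hint' one_mem_valGe (by linarith), coeffAt_one,
          if_neg (mul_ne_zero hppos.ne' h0), sub_zero] at this
    · apply pow_prime_injective
      have hodd : Odd p := hp.out.odd_of_ne_two (by omega)
      simp only [hodd.neg_one_pow]
      rw [← pow_mul, mul_comm, pow_mul, ← coeffAt_pow_prime hint (by rw [hsucc]; exact hlt), hsucc,
        hC']

end MalcevNeumann

namespace MalcevNeumann

variable {p : ℕ} [hp : Fact p.Prime]

open Polynomial

/-! ### The truncated exponential -/

theorem natCast_ne_zero_of_lt {k : ℕ} (h0 : k ≠ 0) (hk : k < p) : (k : Fpbar p) ≠ 0 := by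
  rw [Ne, CharP.cast_eq_zero_iff (Fpbar p) p]
  exact Nat.not_dvd_of_pos_of_lt (Nat.pos_of_ne_zero h0) hk

theorem factorial_ne_zero_of_lt {k : ℕ} (hk : k < p) : (k.factorial : Fpbar p) ≠ 0 := by
  rw [Ne, CharP.cast_eq_zero_iff (Fpbar p) p, hp.out.dvd_factorial]
  omega

theorem constantCoeff_natCast (k : ℕ) :
    WittVector.constantCoeff (k : Wbar p) = (k : Fpbar p) := map_natCast _ k

theorem isUnit_natCast_wbar {k : ℕ} (hk : (k : Fpbar p) ≠ 0) : IsUnit (k : Wbar p) :=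
  WittVector.isUnit_of_coeff_zero_ne_zero _ (by
    have := constantCoeff_natCast (p := p) k
    rw [WittVector.constantCoeff_apply] at this
    rwa [this])

theorem prime_dvd_of_constantCoeff_eq_zero {w : Wbar p}
    (h : WittVector.constantCoeff w = 0) : (p : Wbar p) ∣ w := by
  rw [← RingHom.mem_ker, WittVector.ker_constantCoeff] at h
  exact Ideal.mem_span_singleton.1 h

/-- The inverse of `k!` in the Witt vectors, for `k < p`. -/
noncomputable def invFactorial (p : ℕ) [Fact p.Prime] (k : ℕ) : Wbar p :=
  Ring.inverse (k.factorial : Wbar p)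

theorem factorial_mul_invFactorial {k : ℕ} (hk : k < p) :
    (k.factorial : Wbar p) * invFactorial p k = 1 :=
  Ring.mul_inverse_cancel _ (isUnit_natCast_wbar (factorial_ne_zero_of_lt hk))

theorem constantCoeff_invFactorial {k : ℕ} (hk : k < p) :
    WittVector.constantCoeff (invFactorial p k) = (k.factorial : Fpbar p)⁻¹ := by
  have h := congrArg WittVector.constantCoeff (factorial_mul_invFactorial hk)
  rw [map_mul, constantCoeff_natCast, map_one] at h
  exact eq_inv_of_mul_eq_one_right h

/-- The truncated exponential series `∑_{k < p} T^k / k!`. -/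
noncomputable def truncExp (p : ℕ) [Fact p.Prime] : (Wbar p)[X] :=
  ∑ k ∈ Finset.range p, monomial k (invFactorial p k)

theorem truncExp_coeff (k : ℕ) :
    (truncExp p).coeff k = if k < p then invFactorial p k else 0 := by
  rw [truncExp, finsetSum_coeff]
  simp [coeff_monomial]

theorem truncExp_coeff_zero : (truncExp p).coeff 0 = 1 := by
  have := factorial_mul_invFactorial hp.out.pos
  rw [truncExp_coeff, if_pos hp.out.pos]
  simpa using this

theorem truncExp_coeff_one : (truncExp p).coeff 1 = 1 := by
  have := factorial_mul_invFactorial hp.out.one_lt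
  rw [truncExp_coeff, if_pos hp.out.one_lt]
  simpa using this

theorem derivative_truncExp :
    derivative (truncExp p) = truncExp p - C (invFactorial p (p - 1)) * X ^ (p - 1) := by
  ext1 k
  rw [coeff_derivative, coeff_sub, coeff_C_mul_X_pow, truncExp_coeff, truncExp_coeff]
  rcases lt_trichotomy (k + 1) p with h | h | h
  · rw [if_pos h, if_pos (by omega), if_neg (by omega), sub_zero]
    have h1 := factorial_mul_invFactorial h
    have h2 := factorial_mul_invFactorial (show k < p by omega)
    have h3 := isUnit_natCast_wbar (factorial_ne_zero_of_lt (show k < p by omega))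
    apply h3.mul_left_cancel
    rw [Nat.factorial_succ] at h1
    push_cast at h1
    linear_combination h1 - h2
  · rw [if_neg (by omega), if_pos (by omega), if_pos (by omega), zero_mul]
    rw [show p - 1 = k by omega, sub_self]
  · have := hp.out.pos
    rw [if_neg (by omega), if_neg (by omega), if_neg (by omega), zero_mul, sub_zero]

/-- The defect of `E' = E` is a multiple of `T^(p-1)`, so in low degrees the coefficients of `E^p`
obey the recursion for `exp(pT)`. -/
theorem coeff_truncExp_pow_succ {j : ℕ} (hj : j + 1 < p) :
    (truncExp p ^ p).coeff (j + 1) * ((j + 1 : ℕ) : Wbar p)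
      = p * (truncExp p ^ p).coeff j := by
  have h : derivative (truncExp p ^ p) = C (p : Wbar p) * (truncExp p ^ p
      - (truncExp p ^ (p - 1) * C (invFactorial p (p - 1))) * X ^ (p - 1)) := by
    rw [derivative_pow, derivative_truncExp]
    have : truncExp p ^ p = truncExp p ^ (p - 1) * truncExp p := by
      rw [← pow_succ, Nat.sub_add_cancel hp.out.one_le]
    rw [this]
    ring
  have h1 := congrArg (fun q => coeff q j) h
  simp only [coeff_derivative, coeff_C_mul, coeff_sub, coeff_mul_X_pow'] at h1
  rw [if_neg (by omega), sub_zero] at h1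
  exact_mod_cast h1

theorem coeff_truncExp_pow_zero : (truncExp p ^ p).coeff 0 = 1 := by
  rw [coeff_zero_eq_eval_zero, eval_pow, ← coeff_zero_eq_eval_zero, truncExp_coeff_zero, one_pow]

theorem coeff_truncExp_pow_one : (truncExp p ^ p).coeff 1 = p := by
  have := coeff_truncExp_pow_succ (p := p) (j := 0) hp.out.one_lt
  rw [coeff_truncExp_pow_zero] at this
  simpa using this

theorem sq_dvd_coeff_truncExp_pow {j : ℕ} (h2 : 2 ≤ j) (hj : j < p) :
    (p : Wbar p) ^ 2 ∣ (truncExp p ^ p).coeff j := by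
  induction j, h2 using Nat.le_induction with
  | base =>
    have h := coeff_truncExp_pow_succ (p := p) (j := 1) hj
    rw [coeff_truncExp_pow_one] at h
    rw [← (isUnit_natCast_wbar (natCast_ne_zero_of_lt two_ne_zero hj)).dvd_mul_right]
    exact ⟨1, by rw [h]; ring⟩
  | succ j h2 ih =>
    have h := coeff_truncExp_pow_succ (p := p) (j := j) hj
    rw [← (isUnit_natCast_wbar (natCast_ne_zero_of_lt (Nat.succ_ne_zero j) hj)).dvd_mul_right]
    rw [Nat.succ_eq_add_one, h]
    exact (ih (by omega)).mul_left _

/-- Modulo `p` the coefficients of `E` lie in the prime field, so `E(T)^p = E(T^p)` there. -/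
theorem prime_dvd_coeff_truncExp_pow_sub (j : ℕ) :
    (p : Wbar p) ∣ (truncExp p ^ p - expand (Wbar p) p (truncExp p)).coeff j := by
  apply prime_dvd_of_constantCoeff_eq_zero
  rw [← coeff_map, Polynomial.map_sub, Polynomial.map_pow, map_expand]
  have h : ((truncExp p).map WittVector.constantCoeff).map (frobenius (Fpbar p) p)
      = (truncExp p).map WittVector.constantCoeff := by
    ext1 k
    rw [coeff_map, coeff_map, truncExp_coeff]
    split_ifs with hk
    · rw [constantCoeff_invFactorial hk, map_inv₀, map_natCast]
    · rw [map_zero, map_zero]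
  rw [← map_frobenius_expand, map_expand, h, sub_self, coeff_zero]

/-- The inclusion of the Witt vectors. -/
noncomputable def ofWitt (p : ℕ) [Fact p.Prime] : Wbar p →+* MalcevNeumann p :=
  (mk p).comp HahnSeries.C

theorem ofWitt_mem_valGe (a : Wbar p) : ofWitt p a ∈ valGe p 0 := mk_single_mem_valGe 0 a

/-- The value of the truncated exponential. -/
noncomputable def expVal (w : MalcevNeumann p) : MalcevNeumann p :=
  (truncExp p).eval₂ (ofWitt p) w

theorem eval₂_ofWitt_mem_valGe (F : (Wbar p)[X]) (w : MalcevNeumann p) {x : ℚ}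
    (h : ∀ j, ofWitt p (F.coeff j) * w ^ j ∈ valGe p x) : F.eval₂ (ofWitt p) w ∈ valGe p x := by
  rw [eval₂_eq_sum_range]
  exact sum_mem fun j _ => h j

theorem expVal_sub_mem {w : MalcevNeumann p} {e : ℚ} (he : 0 ≤ e) (hw : w ∈ valGe p e) :
    expVal w - (1 + w) ∈ valGe p (2 * e) := by
  have h : expVal w - (1 + w) = (truncExp p - (1 + X)).eval₂ (ofWitt p) w := by
    rw [eval₂_sub, eval₂_add, eval₂_one, eval₂_X, expVal]
  rw [h]
  refine eval₂_ofWitt_mem_valGe _ _ fun j => ?_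
  rcases j with _ | _ | j
  · rw [coeff_sub, truncExp_coeff_zero]
    simp [zero_mem]
  · rw [coeff_sub, zero_add, truncExp_coeff_one]
    simp [coeff_one, zero_mem]
  · have := mul_mem_valGe (ofWitt_mem_valGe ((truncExp p - (1 + X)).coeff (j + 2)))
      (pow_mem_valGe hw (j + 2))
    refine valGe_mono ?_ this
    push_cast
    nlinarith [mul_nonneg (Nat.cast_nonneg (α := ℚ) j) he]

theorem expVal_sub_one_mem {w : MalcevNeumann p} {e : ℚ} (he : 0 ≤ e) (hw : w ∈ valGe p e) :
    expVal w - 1 ∈ valGe p e := by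
  have := add_mem (valGe_mono (by linarith) (expVal_sub_mem he hw)) hw
  convert this using 1
  ring

theorem expVal_mem {w : MalcevNeumann p} (hw : w ∈ valGe p 0) : expVal w ∈ valGe p 0 := by
  have := add_mem (expVal_sub_one_mem le_rfl hw) one_mem_valGe
  rwa [sub_add_cancel] at this

theorem ofWitt_prime_mul (a : Wbar p) : ofWitt p (p * a) = p * ofWitt p a := by
  rw [map_mul, map_natCast]

/-- The `p`-th power of the truncated exponential. -/
theorem expVal_pow_prime {w : MalcevNeumann p} {e : ℚ} (he : 0 ≤ e) (hw : w ∈ valGe p e) :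
    expVal w ^ p - (expVal (w ^ p) + p * w) ∈ valGe p (min (2 + 2 * e) (1 + p * e)) := by
  have hlt := hp.out.one_lt
  have h : expVal w ^ p - (expVal (w ^ p) + p * w) = (truncExp p ^ p
      - (expand (Wbar p) p (truncExp p) + C (p : Wbar p) * X)).eval₂ (ofWitt p) w := by
    rw [eval₂_sub, eval₂_add, eval₂_mul, eval₂_C, eval₂_X, eval₂_pow, map_natCast,
      eval₂_eq_eval_map (p := expand _ _ _), map_expand, expand_eval, ← eval₂_eq_eval_map, expVal,
      expVal]
  rw [h]
  refine eval₂_ofWitt_mem_valGe _ _ fun j => ?_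
  have hwj := pow_mem_valGe hw j
  -- Degrees `0` and `1` cancel exactly. Degrees `2 ≤ j < p` carry a factor `p^2` and give the bound
  -- `2 + 2e`; degrees `j ≥ p` carry a factor `p` and give `1 + pe`.
  rcases lt_or_ge j p with hj | hj
  · rcases j with _ | _ | j
    · have : (truncExp p ^ p - (expand (Wbar p) p (truncExp p) + C (p : Wbar p) * X)).coeff 0
          = 0 := by
        rw [coeff_sub, coeff_add, coeff_truncExp_pow_zero, coeff_expand hp.out.pos]
        simp [truncExp_coeff_zero]
      rw [this, map_zero, zero_mul]
      exact zero_mem _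
    · have : (truncExp p ^ p - (expand (Wbar p) p (truncExp p) + C (p : Wbar p) * X)).coeff 1
          = 0 := by
        rw [coeff_sub, coeff_add, coeff_truncExp_pow_one, coeff_expand hp.out.pos,
          if_neg (by rw [Nat.dvd_one]; omega)]
        simp
      rw [zero_add, this, map_zero, zero_mul]
      exact zero_mem _
    · have : (truncExp p ^ p - (expand (Wbar p) p (truncExp p)
          + C (p : Wbar p) * X)).coeff (j + 2) = (truncExp p ^ p).coeff (j + 2) := by
        rw [coeff_sub, coeff_add, coeff_expand hp.out.pos,
          if_neg (Nat.not_dvd_of_pos_of_lt (by omega) hj)]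
        simp
      obtain ⟨b, hb⟩ := sq_dvd_coeff_truncExp_pow (p := p) (j := j + 2) (by omega) hj
      rw [this, hb, pow_two, mul_assoc, ofWitt_prime_mul, ofWitt_prime_mul, mul_assoc, mul_assoc,
        prime_mul_mem_valGe, prime_mul_mem_valGe]
      refine valGe_mono ?_ (mul_mem_valGe (ofWitt_mem_valGe b) hwj)
      have h1 := min_le_left (2 + 2 * e) (1 + p * e)
      push_cast
      nlinarith [mul_nonneg (Nat.cast_nonneg (α := ℚ) j) he]
  · obtain ⟨b, hb⟩ := prime_dvd_coeff_truncExp_pow_sub (p := p) j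
    have : (truncExp p ^ p - (expand (Wbar p) p (truncExp p) + C (p : Wbar p) * X)).coeff j
        = p * b := by
      rw [← hb, coeff_sub, coeff_sub, coeff_add, coeff_C_mul, coeff_X, if_neg (by omega),
        mul_zero, add_zero]
    rw [this, ofWitt_prime_mul, mul_assoc, prime_mul_mem_valGe]
    refine valGe_mono ?_ (mul_mem_valGe (ofWitt_mem_valGe b) hwj)
    have h1 := min_le_right (2 + 2 * e) (1 + p * e)
    have h2 : (p : ℚ) ≤ j := by exact_mod_cast hj
    nlinarith [mul_nonneg (sub_nonneg.2 h2) he]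

theorem teich_mul_ppow_mem_valGe (c : Fpbar p) (x : ℚ) : teich p c * ppow p x ∈ valGe p x := by
  rw [teich_mul_ppow]
  exact mk_single_mem_valGe _ _

theorem teich_mul_ppow_pow (c : Fpbar p) (x : ℚ) (k : ℕ) :
    (teich p c * ppow p x) ^ k = teich p (c ^ k) * ppow p (k * x) := by
  rw [mul_pow, ppow_nsmul, map_pow]

/-- The canonical expansion of the truncated exponential of a monomial, at exponents `< 1`. -/
theorem coeffAt_expVal (c : Fpbar p) {e x : ℚ} (he : 0 ≤ e) (hx : x < 1) :
    coeffAt x (expVal (teich p c * ppow p e))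
      = ∑ k ∈ Finset.range p, if x = k * e then c ^ k / k.factorial else 0 := by
  have hterm : ∀ k, ofWitt p (invFactorial p k) * (teich p c * ppow p e) ^ k
      = mk p (HahnSeries.single (k * e) (invFactorial p k * WittVector.teichmuller p (c ^ k))) := by
    intro k
    rw [teich_mul_ppow_pow, teich_mul_ppow, ofWitt, RingHom.comp_apply, ← map_mul]
    congr 1
    rw [HahnSeries.C_apply, HahnSeries.single_mul_single, zero_add]
  have hsum : expVal (teich p c * ppow p e) = ∑ k ∈ Finset.range p,
      ofWitt p (invFactorial p k) * (teich p c * ppow p e) ^ k := by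
    rw [expVal, truncExp, eval₂_finsetSum]
    simp
  have hk0 : ∀ k : ℕ, 0 ≤ (k : ℚ) * e := fun k => mul_nonneg (Nat.cast_nonneg k) he
  -- The coefficients `1/k!` need not be Teichmüller lifts, but below exponent `1` only their
  -- residues matter.
  rw [hsum, coeffAt_sum (m := 0) _ _ _ (by linarith)]
  · refine Finset.sum_congr rfl fun k hk => ?_
    rw [hterm, coeffAt_mk_single _ (by linarith [hk0 k])]
    congr 1
    have := map_mul (WittVector.constantCoeff (R := Fpbar p) (p := p)) (invFactorial p k)
      (WittVector.teichmuller p (c ^ k))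
    rw [constantCoeff_invFactorial (Finset.mem_range.1 hk)] at this
    rw [div_eq_inv_mul]
    exact this.trans (congrArg _ (WittVector.teichmuller_coeff_zero p _))
  · intro k _
    rw [hterm]
    exact valGe_mono (hk0 k) (mk_single_mem_valGe _ _)

/-- The lift squares to `1`, and its residue rules out `1` because `p` is odd. -/
theorem teich_neg_one (h3 : 3 ≤ p) : teich p (-1) = -1 := by
  have h1 : teich p (-1) * teich p (-1) = 1 := by rw [← map_mul]; simp
  rcases mul_self_eq_one_iff.1 h1 with h | h
  · exfalso
    have h2 := coeffAt_zero_teich (-1 : Fpbar p)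
    rw [h, coeffAt_one, if_pos rfl] at h2
    exact natCast_ne_zero_of_lt (p := p) two_ne_zero (by omega) (by push_cast; linear_combination h2)
  · exact h

/-- A `p`-th root of unity is a truncated exponential up to valuation `p / (p - 1)`. -/
theorem sub_expVal_mem (h3 : 3 ≤ p) {η : MalcevNeumann p} (hη : IsPrimitiveRoot η p) :
    η - expVal (teich p (coeffAt (rootExp p 0) η) * ppow p (rootExp p 0))
      ∈ valGe p (1 + rootExp p 0) := by
  obtain ⟨hint, -, hpi, hc⟩ := leading_of_isPrimitiveRoot h3 (N := 0) (by simpa using hη)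
  set e := rootExp p 0 with he
  set c := coeffAt e η
  have hepos : 0 < e := rootExp_pos p 0
  have he1 : e < 1 := rootExp_lt_one p h3 0
  have hpe : ((p : ℚ) - 1) * e = 1 := prime_sub_one_mul_rootExp_zero p
  set w := teich p c * ppow p e with hwdef
  have hw : w ∈ valGe p e := teich_mul_ppow_mem_valGe c e
  have hcast : ((p - 1 : ℕ) : ℚ) = p - 1 := by push_cast [hp.out.one_le]; ring
  have hwp : w ^ p = -(p * w) := by
    have h1 : w ^ (p - 1) = -p := by
      rw [hwdef, teich_mul_ppow_pow, hc, teich_neg_one h3, hcast, hpe, ppow_one, neg_one_mul]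
    calc w ^ p = w ^ (p - 1) * w := by rw [← pow_succ, Nat.sub_add_cancel hp.out.one_le]
      _ = -(p * w) := by rw [h1, neg_mul]
  have hwpe : w ^ p ∈ valGe p (1 + e) := valGe_mono (by linarith) (pow_mem_valGe hw p)
  set E := expVal w with hEdef
  have hE0 : E ∈ valGe p 0 := expVal_mem (valGe_mono hepos.le hw)
  have hE1 : E - 1 ∈ valGe p e := expVal_sub_one_mem hepos.le hw
  -- Up to the two error terms `E ^ p` is `1 + w ^ p + p * w`, whose last two summands cancel. The
  -- bound `1 + p * e` equals `2 + e`.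
  have hEp : E ^ p - 1 ∈ valGe p (2 + e) := by
    have h1 := expVal_pow_prime hepos.le hw
    have h2 := expVal_sub_mem (by linarith) hwpe
    have h3 := add_mem (valGe_mono (le_min (by linarith) (by linarith)) h1)
      (valGe_mono (x := 2 * (1 + e)) (y := 2 + e) (by linarith) h2)
    convert h3 using 1
    rw [hwp]
    ring
  set D := η - E with hD
  have hDmem : D ∈ valGe p e := by
    have := sub_mem hpi hE1
    rwa [sub_sub_sub_cancel_right] at this
  have hDe : coeffAt e D = 0 := by
    rw [hD, coeffAt_sub hint hE0 (by linarith)]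
    rw [hEdef, hwdef, coeffAt_expVal c hepos.le he1, Finset.sum_eq_single 1]
    · simp [c]
    · intro k _ hk1
      refine if_neg fun h => hk1 ?_
      have : (1 : ℚ) * e = k * e := by rw [one_mul]; exact h
      exact_mod_cast (mul_right_cancel₀ hepos.ne' this).symm
    · intro h
      exact absurd (Finset.mem_range.2 hp.out.one_lt) h
  rcases eq_or_ne D 0 with h0 | h0
  · rw [h0]; exact zero_mem _
  obtain ⟨y, hy, hyC⟩ := exists_leading h0
  refine valGe_mono (not_lt.1 fun hlt => ?_) hy
  have hey : e < y := by
    refine lt_of_le_of_ne (le_of_mem_valGe hDmem hyC) ?_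
    rintro rfl
    exact hyC hDe
  obtain ⟨r, hr, hexp⟩ := exists_add_pow_prime hE0 (valGe_mono hepos.le hDmem)
  rw [hD, add_sub_cancel, hη.pow_eq_one, ← hD] at hexp
  -- Isolate the linear term of `(E + D) ^ p = 1`. Its leading exponent is `1 + y`, whereas for `e <
  -- y < 1 + e` every term on the right has valuation strictly above `1 + y`.
  have heq : p * (E ^ (p - 1) * D) = -(E ^ p - 1) - D ^ p - p * (D ^ 2 * r) := by
    linear_combination -hexp
  have hpy : 1 + y < p * y := by
    have h1 := one_lt_prime_cast p
    nlinarith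
  have hR : p * (E ^ (p - 1) * D) ∈ valGe p (min (2 + e) (min (p * y) (1 + 2 * y))) := by
    rw [heq]
    refine sub_mem (sub_mem (neg_mem (valGe_mono (min_le_left _ _) hEp)) (valGe_mono
      ((min_le_right _ _).trans (min_le_left _ _)) (pow_mem_valGe hy p))) (valGe_mono
      ((min_le_right _ _).trans (min_le_right _ _)) ?_)
    rw [prime_mul_mem_valGe]
    have := mul_mem_valGe (pow_mem_valGe hy 2) hr
    convert this using 2
    push_cast
    ring
  have hEC : coeffAt 0 E = 1 := by
    have := coeffAt_sub hE0 one_mem_valGe (show (0 : ℚ) < 0 + 1 by norm_num)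
    rw [hE1 0 hepos, coeffAt_one, if_pos rfl] at this
    exact (sub_eq_zero.1 this.symm)
  have hC : coeffAt (1 + y) ((p : MalcevNeumann p) * (E ^ (p - 1) * D)) = coeffAt y D := by
    rw [coeffAt_prime_mul, add_sub_cancel_left]
    have := coeffAt_add_mul (pow_mem_valGe_zero hE0 (p - 1)) hy
    rw [zero_add, coeffAt_zero_pow hE0, hEC, one_pow, one_mul] at this
    exact this
  have := le_of_mem_valGe hR (by rw [hC]; exact hyC)
  rcases min_le_iff.1 this with h | h
  · linarith
  rcases min_le_iff.1 h with h | h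
  · linarith
  · linarith

end MalcevNeumann

/-! ### The functional equation at order `p ^ 2` and the expansions at all orders. -/

namespace MalcevNeumann

variable {p : ℕ} [hp : Fact p.Prime]

theorem pow_sub_one_mem_valGe {A : MalcevNeumann p} {e : ℚ} (hA0 : A ∈ valGe p 0)
    (hA : A - 1 ∈ valGe p e) (k : ℕ) : A ^ k - 1 ∈ valGe p e := by
  induction k with
  | zero => simp [zero_mem]
  | succ k ih =>
    have h := add_mem (mul_mem_valGe (pow_mem_valGe_zero hA0 k) hA) (valGe_mono (by linarith) ih)
    rw [zero_add] at h
    convert h using 1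
    ring

/-- The functional equation satisfied by the difference between a root of unity of order `p ^ 2`
and the truncated exponential of its leading term. -/
theorem sub_expVal_equation (h3 : 3 ≤ p) {ζ : MalcevNeumann p}
    (hζ : IsPrimitiveRoot ζ (p ^ 2)) {c : Fpbar p} (hc : coeffAt (rootExp p 1) ζ = c)
    {D : MalcevNeumann p} (hD : D = ζ - expVal (teich p c * ppow p (rootExp p 1))) :
    D ∈ valGe p ((1 + rootExp p 1) / p) ∧ ∀ x < rootExp p 0,
      coeffAt ((1 + x) / p) D ^ p = -(coeffAt x D + if x = rootExp p 1 then c else 0) := by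
  obtain ⟨hint, -, -, -⟩ := leading_of_isPrimitiveRoot h3 (N := 1) hζ
  have h1p := one_lt_prime_cast p
  have hsucc := prime_mul_rootExp_succ p 0
  have hpe0 := prime_sub_one_mul_rootExp_zero p
  have he0 := rootExp_lt_one p h3 0
  have he1 := rootExp_pos p 1
  have hle := rootExp_succ_le p 0
  have hη := sub_expVal_mem h3 (hζ.pow (pow_pos hp.out.pos 2) (sq p) : IsPrimitiveRoot (ζ ^ p) p)
  have hcη : coeffAt (rootExp p 0) (ζ ^ p) = c ^ p := by
    rw [← hc, ← coeffAt_pow_prime hint (by rw [hsucc]; exact he0), hsucc]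
  rw [hcη] at hη
  rw [zero_add] at hsucc hle
  set e₀ := rootExp p 0
  set e₁ := rootExp p 1
  obtain ⟨δ, hδ⟩ : ∃ δ, δ = (1 + e₁) / p := ⟨_, rfl⟩
  have hpδ : p * δ = 1 + e₁ := by rw [hδ]; field_simp
  rw [← hδ]
  set w := teich p c * ppow p e₁ with hwdef
  have hw : w ∈ valGe p e₁ := teich_mul_ppow_mem_valGe c e₁
  have hwp : w ^ p = teich p (c ^ p) * ppow p e₀ := by rw [hwdef, teich_mul_ppow_pow, hsucc]
  rw [← hwp] at hη
  have hE0 : expVal w ∈ valGe p 0 := expVal_mem (valGe_mono he1.le hw)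
  have hE1 : expVal w - 1 ∈ valGe p e₁ := expVal_sub_one_mem he1.le hw
  have hEp := expVal_pow_prime he1.le hw
  have hD0 : D ∈ valGe p 0 := by rw [hD]; exact sub_mem hint hE0
  obtain ⟨r, hr, hexp⟩ := exists_add_pow_prime hE0 hD0
  have hED : expVal w + D = ζ := by rw [hD]; ring
  rw [hED] at hexp
  -- Subtract the expansion of `expVal w ^ p` from that of `ζ ^ p`; both are known modulo valuation
  -- `1 + e₀ = 1 + p * e₁`.
  have hS : D ^ p + p * (expVal w ^ (p - 1) * D) + p * (D ^ 2 * r) + p * w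
      ∈ valGe p (1 + e₀) := by
    have h := sub_mem hη (valGe_mono (y := 1 + e₀) (le_min (by linarith) (by linarith)) hEp)
    convert h using 1
    rw [hexp]
    ring
  have hp0 : (0 : ℚ) < p := by linarith
  have hpw : p * w ∈ valGe p (1 + e₁) := prime_mul_mem_valGe.2 (by simpa using hw)
  -- If `D` started at some `y < δ`, then `D ^ p` would start at `p * y`, strictly below `1 + y` and
  -- `1 + e₁`, and nothing could cancel it.
  have hDδ : D ∈ valGe p δ := by
    rcases eq_or_ne D 0 with h0 | h0
    · rw [h0]; exact zero_mem _
    obtain ⟨y, hy, hyC⟩ := exists_leading h0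
    refine valGe_mono (not_lt.1 fun hlt => ?_) hy
    have hy0 : 0 ≤ y := le_of_mem_valGe hD0 hyC
    have hye : p * y < p * δ := by gcongr
    have hye0 : p * y < 1 + y := by nlinarith
    have heq : D ^ p = (D ^ p + p * (expVal w ^ (p - 1) * D) + p * (D ^ 2 * r) + p * w)
        - p * (expVal w ^ (p - 1) * D) - p * (D ^ 2 * r) - p * w := by ring
    have hR : D ^ p ∈ valGe p (min (1 + y) (1 + e₁)) := by
      rw [heq]
      refine sub_mem (sub_mem (sub_mem (valGe_mono ((min_le_right _ _).trans (by linarith)) hS)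
        (valGe_mono (min_le_left _ _) (prime_mul_mem_valGe.2 ?_)))
        (valGe_mono (min_le_left _ _) (prime_mul_mem_valGe.2 ?_)))
        (valGe_mono (min_le_right _ _) hpw)
      · have := mul_mem_valGe (pow_mem_valGe_zero hE0 (p - 1)) hy
        simpa using this
      · have := mul_mem_valGe (pow_mem_valGe hy 2) hr
        refine valGe_mono ?_ this
        push_cast
        linarith
    have := le_of_mem_valGe hR (by rw [coeffAt_mul_pow hy p]; exact pow_ne_zero _ hyC)
    rcases min_le_iff.1 this with h | h <;> linarith
  refine ⟨hDδ, fun x hx => ?_⟩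
  have hδe0 : e₀ ≤ e₁ + δ := le_of_mul_le_mul_left (by linarith) hp0
  have hδe0' : e₀ ≤ 2 * δ := le_of_mul_le_mul_left (by linarith) hp0
  have hδe1 : e₁ ≤ δ := le_of_mul_le_mul_left (by linarith) hp0
  -- With `D` of valuation `≥ δ`, the factor `expVal w ^ (p - 1)` may be replaced by `1` and the
  -- quadratic term dropped, since `e₀ ≤ e₁ + δ` and `e₀ ≤ 2 * δ`.
  have hT : D ^ p + p * D + p * w ∈ valGe p (1 + e₀) := by
    have h1 : p * ((expVal w ^ (p - 1) - 1) * D) ∈ valGe p (1 + e₀) :=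
      prime_mul_mem_valGe.2 (valGe_mono (by linarith)
        (mul_mem_valGe (pow_sub_one_mem_valGe hE0 hE1 _) hDδ))
    have h2 : p * (D ^ 2 * r) ∈ valGe p (1 + e₀) :=
      prime_mul_mem_valGe.2 (valGe_mono (by push_cast; linarith)
        (mul_mem_valGe (pow_mem_valGe hDδ 2) hr))
    have h := sub_mem (sub_mem hS h1) h2
    convert h using 1
    ring
  have hDp : D ^ p ∈ valGe p (1 + e₁) := by rw [← hpδ]; exact pow_mem_valGe hDδ p
  have hpD : p * D ∈ valGe p (1 + e₁) :=
    prime_mul_mem_valGe.2 (valGe_mono (by linarith) hDδ)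
  have h := hT (1 + x) (by linarith)
  rw [coeffAt_add (add_mem hDp hpD) hpw (by linarith), coeffAt_add hDp hpD (by linarith),
    coeffAt_prime_mul, coeffAt_prime_mul, add_sub_cancel_left, hwdef,
    coeffAt_teich_mul_ppow] at h
  have hdiv : p * ((1 + x) / p) = 1 + x := by field_simp
  rw [← coeffAt_prime_mul_pow hDδ (by rw [hdiv, hpδ]; linarith), hdiv]
  linear_combination h

open scoped Classical in
/-- The terms `c p^(e - 1/p^l)`, `l ≥ n`. -/
noncomputable def limitTerm (p n : ℕ) [Fact p.Prime] (e : ℚ) (c : Fpbar p) (x : ℚ) : Fpbar p :=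
  if ∃ l, n ≤ l ∧ x = e - 1 / (p : ℚ) ^ l then c else 0

/-- The solution of the functional equation. -/
theorem coeffAt_sub_expVal (h3 : 3 ≤ p) {ζ : MalcevNeumann p}
    (hζ : IsPrimitiveRoot ζ (p ^ 2)) {c : Fpbar p} (hc : coeffAt (rootExp p 1) ζ = c)
    {x : ℚ} (hx : x < rootExp p 0) :
    coeffAt x (ζ - expVal (teich p c * ppow p (rootExp p 1)))
      = limitTerm p 2 (rootExp p 0) c x := by
  obtain ⟨hδ, hrec⟩ := sub_expVal_equation h3 hζ hc rfl
  set D := ζ - expVal (teich p c * ppow p (rootExp p 1))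
  have hcp : c ^ p = -c := by
    have h := (leading_of_isPrimitiveRoot h3 (N := 1) hζ).2.2.2
    rw [hc] at h
    calc c ^ p = c ^ (p - 1) * c := by rw [← pow_succ, Nat.sub_add_cancel hp.out.one_le]
      _ = -c := by rw [h, neg_one_mul]
  have h1p := one_lt_prime_cast p
  have hp0 : (0 : ℚ) < p := by linarith
  have hpe0 := prime_sub_one_mul_rootExp_zero p
  have hsub := rootExp_zero_sub p
  have he1 := rootExp_pos p 1
  have hpe1 := prime_mul_rootExp_succ p 0
  have he0 := rootExp_lt_one p h3 0
  rw [zero_add] at hpe1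
  set e₀ := rootExp p 0
  set e₁ := rootExp p 1
  have hpow : ∀ l : ℕ, p * (1 / (p : ℚ) ^ (l + 1)) = 1 / (p : ℚ) ^ l := fun l => by
    field_simp
    ring
  have hlt : ∀ l : ℕ, 2 ≤ l → 1 / (p : ℚ) ^ l < 1 / p := fun l hl =>
    one_div_lt_one_div_of_lt hp0 (lt_self_pow₀ h1p hl)
  -- As `e₁ = e₀ - 1/p`, these exponents lie below the first term, at `e₀ - 1/p^2 = (1 + e₁)/p`.
  have hlow : ∀ y ≤ e₁, coeffAt y D = 0 ∧ limitTerm p 2 e₀ c y = 0 := by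
    intro y hy
    refine ⟨hδ y ?_, if_neg ?_⟩
    · rw [lt_div_iff₀ hp0]
      nlinarith
    · rintro ⟨l, hl, rfl⟩
      have := hlt l hl
      linarith
  -- Since `p * e₀ = 1 + e₀`, passing from `y` to `p * y - 1` multiplies the distance to `e₀` by
  -- `p`; after finitely many passes it is at least `1/p`, where `hlow` applies.
  have main : ∀ N : ℕ, ∀ y < e₀, 1 / (p : ℚ) ^ (N + 1) ≤ e₀ - y →
      coeffAt y D = limitTerm p 2 e₀ c y := by
    intro N
    induction N with
    | zero =>
      intro y _ hy
      rw [zero_add, pow_one] at hy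
      have := hlow y (by linarith)
      rw [this.1, this.2]
    | succ N ih =>
      intro y hy hN
      have hy' : p * y - 1 < e₀ := by nlinarith
      have hih := ih (p * y - 1) hy' (by
        rw [← hpow (N + 1)]
        nlinarith [mul_le_mul_of_nonneg_left hN hp0.le])
      have h := hrec _ hy'
      rw [hih] at h
      have hdiv : (1 + (p * y - 1)) / p = y := by field_simp; ring
      rw [hdiv] at h
      apply pow_prime_injective
      simp only
      rw [h]
      -- The source term acts exactly here, at `y = e₀ - 1/p^2`; all later terms are inherited from
      -- the preceding one.
      by_cases h1 : p * y - 1 = e₁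
      · rw [if_pos h1, (hlow _ h1.le).2, zero_add]
        have : limitTerm p 2 e₀ c y = c := by
          refine if_pos ⟨2, le_rfl, mul_left_cancel₀ hp0.ne' ?_⟩
          rw [mul_sub, hpow 1, pow_one]
          linarith
        rw [this, hcp]
      · rw [if_neg h1, add_zero]
        by_cases h2 : ∃ l, 2 ≤ l ∧ p * y - 1 = e₀ - 1 / (p : ℚ) ^ l
        · have h3 : limitTerm p 2 e₀ c (p * y - 1) = c := if_pos h2
          have h4 : limitTerm p 2 e₀ c y = c := by
            obtain ⟨l, hl, h2⟩ := h2
            refine if_pos ⟨l + 1, by omega, mul_left_cancel₀ hp0.ne' ?_⟩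
            rw [mul_sub, hpow l]
            linarith
          rw [h3, h4, hcp]
        · have h3 : limitTerm p 2 e₀ c (p * y - 1) = 0 := if_neg h2
          have h4 : limitTerm p 2 e₀ c y = 0 := by
            refine if_neg ?_
            rintro ⟨l, hl, hyl⟩
            obtain ⟨l, rfl⟩ : ∃ m, l = m + 1 := ⟨l - 1, by omega⟩
            have hpy : p * y = p * e₀ - 1 / (p : ℚ) ^ l := by rw [hyl, mul_sub, hpow l]
            rcases Nat.lt_or_ge l 2 with hl' | hl'
            · obtain rfl : l = 1 := by omega
              rw [pow_one] at hpy
              exact h1 (by linarith)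
            · exact h2 ⟨l, hl', by linarith⟩
          rw [h3, h4, neg_zero, zero_pow hp.out.ne_zero]
  obtain ⟨N, hN⟩ := exists_pow_lt_of_lt_one (sub_pos.2 hx)
    (show 1 / (p : ℚ) < 1 by rw [div_lt_one hp0]; exact h1p)
  refine main N x hx (le_trans ?_ hN.le)
  rw [one_div_pow]
  exact one_div_le_one_div_of_le (by positivity) (pow_le_pow_right₀ h1p.le (Nat.le_succ N))

/-- The first `p` terms. -/
noncomputable def expTerm (p : ℕ) [Fact p.Prime] (e : ℚ) (c : Fpbar p) (x : ℚ) : Fpbar p :=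
  ∑ k ∈ Finset.range p, if x = k * e then c ^ k / k.factorial else 0

/-- The canonical expansion of a root of unity of order `p ^ (N + 2)` at exponents smaller than
`1 / (p ^ N (p - 1))`. -/
theorem coeffAt_rootOfUnity (h3 : 3 ≤ p) {N : ℕ} {ζ : MalcevNeumann p}
    (hζ : IsPrimitiveRoot ζ (p ^ (N + 2))) {c : Fpbar p}
    (hc : coeffAt (rootExp p (N + 1)) ζ = c) {x : ℚ} (hx : x < rootExp p N) :
    coeffAt x ζ = expTerm p (rootExp p (N + 1)) c x + limitTerm p (N + 2) (rootExp p N) c x := by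
  have h1p := one_lt_prime_cast p
  have hp0 : (0 : ℚ) < p := by linarith
  induction N generalizing ζ c x with
  | zero =>
    have he1 := rootExp_pos p 1
    have he0 := rootExp_lt_one p h3 0
    have hint := (leading_of_isPrimitiveRoot h3 (N := 1) hζ).1
    have hE : expVal (teich p c * ppow p (rootExp p 1)) ∈ valGe p 0 :=
      expVal_mem (valGe_mono he1.le (teich_mul_ppow_mem_valGe c _))
    rw [← coeffAt_sub_expVal h3 hζ hc hx, coeffAt_sub hint hE (by linarith), expTerm,
      ← coeffAt_expVal c he1.le (by linarith), add_sub_cancel]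
  | succ N ih =>
    have hint := (leading_of_isPrimitiveRoot h3 (N := N + 2) hζ).1
    have hζp : IsPrimitiveRoot (ζ ^ p) (p ^ (N + 2)) :=
      hζ.pow (pow_pos hp.out.pos _) (by ring)
    have hN := prime_mul_rootExp_succ p N
    have hN1 := prime_mul_rootExp_succ p (N + 1)
    have hlt := rootExp_lt_one p h3 N
    have hlt1 := rootExp_lt_one p h3 (N + 1)
    have hpx : p * x < rootExp p N := by rw [← hN]; gcongr
    have hcp : coeffAt (rootExp p (N + 1)) (ζ ^ p) = c ^ p := by
      rw [← hc, ← coeffAt_pow_prime hint (by rw [hN1]; exact hlt1), hN1]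
    apply pow_prime_injective
    simp only
    -- Compare `p`-th powers. Frobenius fixes the factorials and sends `c` to `c ^ p`; dividing
    -- exponents by `p` raises the index `l` by one.
    rw [← coeffAt_pow_prime hint (by linarith), ih hζp hcp hpx, add_pow_char]
    congr 1
    · refine Eq.trans ?_ (map_sum (frobenius (Fpbar p) p) _ _).symm
      refine Finset.sum_congr rfl fun k _ => ?_
      have hiff : p * x = k * rootExp p (N + 1) ↔ x = k * rootExp p (N + 2) := by
        rw [← hN1, mul_left_comm]
        exact mul_right_inj' hp0.ne'
      simp only [hiff]
      split_ifs
      · rw [map_div₀, map_natCast, map_pow, frobenius_def]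
      · rw [map_zero]
    · have hiff : (∃ l, N + 2 ≤ l ∧ p * x = rootExp p N - 1 / (p : ℚ) ^ l) ↔
          ∃ l, N + 3 ≤ l ∧ x = rootExp p (N + 1) - 1 / (p : ℚ) ^ l := by
        have hl : ∀ l : ℕ, p * x = rootExp p N - 1 / (p : ℚ) ^ l ↔
            x = rootExp p (N + 1) - 1 / (p : ℚ) ^ (l + 1) := fun l => by
          rw [← hN, ← mul_right_inj' hp0.ne' (b := x), mul_sub]
          have : p * (1 / (p : ℚ) ^ (l + 1)) = 1 / (p : ℚ) ^ l := by field_simp; ring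
          rw [this]
        constructor
        · rintro ⟨l, h, hxl⟩
          exact ⟨l + 1, by omega, (hl l).1 hxl⟩
        · rintro ⟨l, h, hxl⟩
          obtain ⟨l, rfl⟩ : ∃ m, l = m + 1 := ⟨l - 1, by omega⟩
          exact ⟨l, by omega, (hl l).2 hxl⟩
      by_cases h : ∃ l, N + 2 ≤ l ∧ p * x = rootExp p N - 1 / (p : ℚ) ^ l
      · rw [limitTerm, limitTerm, if_pos h, if_pos (hiff.1 h)]
      · rw [limitTerm, limitTerm, if_neg h, if_neg (mt hiff.2 h), zero_pow hp.out.ne_zero]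

end MalcevNeumann

/-! ### Prescribing the coefficient after the constant term. -/

namespace MalcevNeumann

variable {p : ℕ} [hp : Fact p.Prime]

open Polynomial

theorem exists_natCast_eq_of_pow_eq_one {t : Fpbar p} (ht : t ^ (p - 1) = 1) :
    ∃ a : ℕ, (a : Fpbar p) = t := by
  have htp : t ^ p = t := by
    calc t ^ p = t ^ (p - 1) * t := by rw [← pow_succ, Nat.sub_add_cancel hp.out.one_le]
      _ = t := by rw [ht, one_mul]
  have h := (Subfield.mem_bot_iff_pow_eq_self (Fpbar p) p).2 htp
  rw [← ZMod.fieldRange_castHom_eq_bot p] at h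
  obtain ⟨a, rfl⟩ := h
  exact ⟨a.val, by rw [← map_natCast (ZMod.castHom (dvd_refl p) (Fpbar p)), ZMod.natCast_zmod_val]⟩

/-- This is the first-order term of `(1 + π)^a`. Powers of one root of unity thus reach every
prime-field multiple of its coefficient. -/
theorem coeffAt_rootExp_pow (h3 : 3 ≤ p) {N : ℕ} {ζ : MalcevNeumann p}
    (hζ : IsPrimitiveRoot ζ (p ^ (N + 1))) (a : ℕ) :
    coeffAt (rootExp p N) (ζ ^ a) = a * coeffAt (rootExp p N) ζ := by
  obtain ⟨hint, hC0, hpi, -⟩ := leading_of_isPrimitiveRoot h3 hζ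
  have he := rootExp_pos p N
  have he1 := rootExp_lt_one p h3 N
  have hsub : coeffAt (rootExp p N) (ζ - 1) = coeffAt (rootExp p N) ζ := by
    rw [coeffAt_sub hint one_mem_valGe (by linarith), coeffAt_one, if_neg he.ne', sub_zero]
  induction a with
  | zero => rw [pow_zero, coeffAt_one, if_neg he.ne', Nat.cast_zero, zero_mul]
  | succ a ih =>
    have hmul := mul_mem_valGe (pow_mem_valGe_zero hint a) hpi
    have h := coeffAt_add_mul (pow_mem_valGe_zero hint a) hpi
    rw [zero_add] at hmul h
    have h2 : ζ ^ (a + 1) = ζ ^ a + ζ ^ a * (ζ - 1) := by ring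
    rw [h2, coeffAt_add (pow_mem_valGe_zero hint a) (valGe_mono he.le hmul) (by linarith), ih, h,
      coeffAt_zero_pow hint, hC0, one_pow, one_mul, hsub]
    push_cast
    ring

theorem neZero_prime_pow (k : ℕ) : NeZero ((p ^ k : ℕ) : MalcevNeumann p) := by
  refine ⟨?_⟩
  rw [Nat.cast_pow, ← ppow_one]
  exact pow_ne_zero _ (ppow_ne_zero 1)

/-- Roots of unity with any prescribed leading coefficient `c`, `c ^ (p - 1) = -1`. -/
theorem exists_isPrimitiveRoot (h3 : 3 ≤ p) (N : ℕ) {c : Fpbar p} (hc : c ^ (p - 1) = -1) :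
    ∃ ζ : MalcevNeumann p, IsPrimitiveRoot ζ (p ^ (N + 1)) ∧ coeffAt (rootExp p N) ζ = c := by
  have := neZero_prime_pow (p := p) (N + 1)
  obtain ⟨ζ, hζ⟩ := HasEnoughRootsOfUnity.exists_primitiveRoot (MalcevNeumann p) (p ^ (N + 1))
  have hc₀ := (leading_of_isPrimitiveRoot h3 hζ).2.2.2
  set c₀ := coeffAt (rootExp p N) ζ with hc₀'
  have hne : c₀ ≠ 0 := by
    intro h
    have hp1 : p - 1 ≠ 0 := by omega
    rw [h, zero_pow hp1] at hc₀
    exact neg_ne_zero.2 one_ne_zero hc₀.symm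
  -- Both coefficients have `(p-1)`-th power `-1`, so their ratio lies in the prime field; it is
  -- nonzero, which makes `a` prime to `p`.
  obtain ⟨a, ha⟩ := exists_natCast_eq_of_pow_eq_one (p := p) (t := c / c₀) (by
    rw [div_pow, hc, hc₀, div_self (neg_ne_zero.2 one_ne_zero)])
  have hac : coeffAt (rootExp p N) (ζ ^ a) = c := by
    rw [coeffAt_rootExp_pow h3 hζ, ha, ← hc₀', div_mul_cancel₀ _ hne]
  refine ⟨ζ ^ a, hζ.pow_of_coprime a ?_, hac⟩
  refine Nat.Coprime.pow_right _ (Nat.Coprime.symm ((Nat.Prime.coprime_iff_not_dvd hp.out).2 ?_))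
  intro hdvd
  rw [← CharP.cast_eq_zero_iff (Fpbar p) p, ha, div_eq_zero_iff, or_iff_left hne] at hdvd
  have hp1 : p - 1 ≠ 0 := by omega
  rw [hdvd, zero_pow hp1] at hc
  exact neg_ne_zero.2 one_ne_zero hc.symm

/-! ### The terms of the expansion as a sequence -/

/-- The `j`-th exponent in the expansion of roots of unity of order `p ^ (N + 2)`. -/
noncomputable def stepExp (p N j : ℕ) : ℚ :=
  if j < p then j * rootExp p (N + 1) else rootExp p N - 1 / (p : ℚ) ^ (j - p + (N + 2))

/-- The `j`-th coefficient in the expansion of roots of unity of order `p ^ (N + 2)`. -/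
noncomputable def stepCoeff (c : Fpbar p) (j : ℕ) : Fpbar p :=
  if j < p then c ^ j / j.factorial else c

/-- The sum of the first `j` terms. -/
noncomputable def approx (N : ℕ) (c : Fpbar p) (j : ℕ) : MalcevNeumann p :=
  ∑ i ∈ Finset.range j, teich p (stepCoeff c i) * ppow p (stepExp p N i)

theorem one_div_pow_lt_rootExp (N l : ℕ) (hl : N + 2 ≤ l) :
    1 / (p : ℚ) ^ l < rootExp p (N + 1) := by
  have h := one_lt_prime_cast p
  have h0 : (0 : ℚ) < p - 1 := by linarith
  rw [rootExp]
  refine one_div_lt_one_div_of_lt (by positivity) ?_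
  calc (p : ℚ) ^ (N + 1) * (p - 1) < (p : ℚ) ^ (N + 1) * p := by gcongr; linarith
    _ = (p : ℚ) ^ (N + 2) := by ring
    _ ≤ (p : ℚ) ^ l := pow_le_pow_right₀ h.le hl

/-- The last exponential term sits at `e_N - e_(N+1)`, and `1/p^l < e_(N+1)`; so the two families of
exponents do not interleave. -/
theorem mul_rootExp_lt_sub {N l k : ℕ} (hl : N + 2 ≤ l) (hk : k < p) :
    k * rootExp p (N + 1) < rootExp p N - 1 / (p : ℚ) ^ l := by
  have h1 := one_div_pow_lt_rootExp (p := p) N l hl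
  have h2 : (k : ℚ) + 1 ≤ p := by exact_mod_cast hk
  have h3 := prime_mul_rootExp_succ p N
  nlinarith [rootExp_pos p (N + 1)]

theorem stepExp_strictMono (N : ℕ) : StrictMono (stepExp p N) := by
  have h := one_lt_prime_cast p
  refine strictMono_nat_of_lt_succ fun j => ?_
  rw [stepExp, stepExp]
  rcases lt_trichotomy (j + 1) p with hj | hj | hj
  · rw [if_pos (by omega), if_pos hj]
    have := rootExp_pos p (N + 1)
    push_cast
    linarith
  · rw [if_pos (by omega), if_neg (by omega)]
    exact mul_rootExp_lt_sub (by omega) (by omega)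
  · rw [if_neg (by omega), if_neg (by omega)]
    have : 1 / (p : ℚ) ^ (j + 1 - p + (N + 2)) < 1 / (p : ℚ) ^ (j - p + (N + 2)) :=
      one_div_lt_one_div_of_lt (by positivity) (pow_lt_pow_right₀ h (by omega))
    linarith

theorem stepExp_zero (N : ℕ) : stepExp p N 0 = 0 := by
  rw [stepExp, if_pos hp.out.pos, Nat.cast_zero, zero_mul]

theorem stepExp_one (N : ℕ) : stepExp p N 1 = rootExp p (N + 1) := by
  rw [stepExp, if_pos hp.out.one_lt, Nat.cast_one, one_mul]

theorem stepExp_nonneg (N j : ℕ) : 0 ≤ stepExp p N j := by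
  rw [← stepExp_zero (p := p) N]
  exact (stepExp_strictMono N).monotone (Nat.zero_le j)

theorem stepExp_lt (N j : ℕ) : stepExp p N j < rootExp p N := by
  have h := one_lt_prime_cast p
  have hpos : (0 : ℚ) < 1 / (p : ℚ) ^ (j + (N + 2)) := by positivity
  calc stepExp p N j ≤ stepExp p N (p + j) := (stepExp_strictMono N).monotone (by omega)
    _ = rootExp p N - 1 / (p : ℚ) ^ (j + (N + 2)) := by
      rw [stepExp, if_neg (by omega), Nat.add_sub_cancel_left]
    _ < rootExp p N := by linarith

theorem stepCoeff_zero (c : Fpbar p) : stepCoeff c 0 = 1 := by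
  rw [stepCoeff, if_pos hp.out.pos]
  simp

theorem stepCoeff_one (c : Fpbar p) : stepCoeff c 1 = c := by
  rw [stepCoeff, if_pos hp.out.one_lt]
  simp

theorem stepCoeff_ne_zero {c : Fpbar p} (hc : c ≠ 0) (j : ℕ) : stepCoeff c j ≠ 0 := by
  rw [stepCoeff]
  split_ifs with h
  · exact div_ne_zero (pow_ne_zero _ hc) (factorial_ne_zero_of_lt h)
  · exact hc

theorem expTerm_add_limitTerm_stepExp (N : ℕ) (c : Fpbar p) (j : ℕ) :
    expTerm p (rootExp p (N + 1)) c (stepExp p N j)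
      + limitTerm p (N + 2) (rootExp p N) c (stepExp p N j) = stepCoeff c j := by
  have he := rootExp_pos p (N + 1)
  rw [stepExp, stepCoeff]
  split_ifs with hj
  · have h1 : limitTerm p (N + 2) (rootExp p N) c (j * rootExp p (N + 1)) = 0 :=
      if_neg fun ⟨l, hl, h⟩ => (mul_rootExp_lt_sub hl hj).ne h
    rw [h1, add_zero, expTerm, Finset.sum_eq_single j, if_pos rfl]
    · intro k _ hk
      refine if_neg fun h => hk ?_
      exact_mod_cast (mul_right_cancel₀ he.ne' h).symm
    · intro h
      exact absurd (Finset.mem_range.2 hj) h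
  · have h1 : limitTerm p (N + 2) (rootExp p N) c
        (rootExp p N - 1 / (p : ℚ) ^ (j - p + (N + 2))) = c :=
      if_pos ⟨_, by omega, rfl⟩
    rw [h1, expTerm, Finset.sum_eq_zero, zero_add]
    intro k hk
    exact if_neg (mul_rootExp_lt_sub (by omega) (Finset.mem_range.1 hk)).ne'

theorem expTerm_add_limitTerm_of_ne {N : ℕ} (c : Fpbar p) {x : ℚ}
    (hx : ∀ j, x ≠ stepExp p N j) :
    expTerm p (rootExp p (N + 1)) c x + limitTerm p (N + 2) (rootExp p N) c x = 0 := by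
  have h1 : limitTerm p (N + 2) (rootExp p N) c x = 0 := by
    refine if_neg ?_
    rintro ⟨l, hl, h⟩
    refine hx (p + (l - (N + 2))) ?_
    rw [stepExp, if_neg (by omega), Nat.add_sub_cancel_left, Nat.sub_add_cancel hl, h]
  rw [h1, add_zero, expTerm]
  refine Finset.sum_eq_zero fun k hk => if_neg fun h => hx k ?_
  rw [stepExp, if_pos (Finset.mem_range.1 hk), h]

theorem approx_mem (N : ℕ) (c : Fpbar p) (j : ℕ) : approx N c j ∈ valGe p 0 :=
  sum_mem fun i _ => valGe_mono (stepExp_nonneg N i) (teich_mul_ppow_mem_valGe _ _)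

theorem coeffAt_approx (N : ℕ) (c : Fpbar p) (j : ℕ) {x : ℚ} (hx : x < 1) :
    coeffAt x (approx N c j)
      = ∑ i ∈ Finset.range j, if x = stepExp p N i then stepCoeff c i else 0 := by
  rw [approx, coeffAt_sum (m := 0) _ _
    (fun i _ => valGe_mono (stepExp_nonneg N i) (teich_mul_ppow_mem_valGe _ _)) (by linarith)]
  exact Finset.sum_congr rfl fun i _ => coeffAt_teich_mul_ppow _ _ _

/-! ### The run of the Newton algorithm. -/

section Run

variable (h3 : 3 ≤ p) {N : ℕ} {c : Fpbar p} {ζ : MalcevNeumann p}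

include h3

theorem coeffAt_stepExp (hζ : IsPrimitiveRoot ζ (p ^ (N + 2)))
    (hc : coeffAt (rootExp p (N + 1)) ζ = c) (j : ℕ) :
    coeffAt (stepExp p N j) ζ = stepCoeff c j := by
  rw [coeffAt_rootOfUnity h3 hζ hc (stepExp_lt N j), expTerm_add_limitTerm_stepExp]

theorem coeffAt_of_ne_stepExp (hζ : IsPrimitiveRoot ζ (p ^ (N + 2)))
    (hc : coeffAt (rootExp p (N + 1)) ζ = c) {x : ℚ} (hx : x < rootExp p N)
    (hx' : ∀ j, x ≠ stepExp p N j) : coeffAt x ζ = 0 := by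
  rw [coeffAt_rootOfUnity h3 hζ hc hx, expTerm_add_limitTerm_of_ne c hx']

/-- The exponents `stepExp` enumerate the support below `rootExp p N` in increasing order, so
removing `j` terms leaves the next one leading. -/
theorem sub_approx_leading (hζ : IsPrimitiveRoot ζ (p ^ (N + 2)))
    (hc : coeffAt (rootExp p (N + 1)) ζ = c) (j : ℕ) :
    ζ - approx N c j ∈ valGe p (stepExp p N j) ∧
      coeffAt (stepExp p N j) (ζ - approx N c j) = stepCoeff c j := by
  have hint := (leading_of_isPrimitiveRoot h3 (N := N + 1) hζ).1
  have hlt := stepExp_lt (p := p) N j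
  have hlt1 := rootExp_lt_one p h3 N
  have hcoeff : ∀ x < 1, coeffAt x (ζ - approx N c j) = coeffAt x ζ
      - ∑ i ∈ Finset.range j, if x = stepExp p N i then stepCoeff c i else 0 := fun x hx => by
    rw [coeffAt_sub hint (approx_mem N c j) (by linarith), coeffAt_approx N c j hx]
  constructor
  · intro x hx
    rw [hcoeff x (by linarith)]
    by_cases h : ∃ i, x = stepExp p N i
    · obtain ⟨i, rfl⟩ := h
      rw [coeffAt_stepExp h3 hζ hc, Finset.sum_eq_single i, if_pos rfl, sub_self]
      · exact fun k _ hk => if_neg fun h => hk ((stepExp_strictMono N).injective h).symm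
      · exact fun h => absurd (Finset.mem_range.2 ((stepExp_strictMono N).lt_iff_lt.1 hx)) h
    · push Not at h
      rw [coeffAt_of_ne_stepExp h3 hζ hc (hx.trans hlt) h,
        Finset.sum_eq_zero fun i _ => if_neg (h i), sub_zero]
  · rw [hcoeff _ (by linarith), coeffAt_stepExp h3 hζ hc, Finset.sum_eq_zero, sub_zero]
    intro i hi
    exact if_neg ((stepExp_strictMono N) (Finset.mem_range.1 hi)).ne'

/-- Compare with a root of unity that does have coefficient `c`: the two differ at `rootExp p (N +
1)`, while the partial sum follows the latter beyond that exponent. -/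
theorem sub_approx_leading_of_ne (hc : c ^ (p - 1) = -1) (hζ : IsPrimitiveRoot ζ (p ^ (N + 2)))
    (hne : coeffAt (rootExp p (N + 1)) ζ ≠ c) {j : ℕ} (hj : 2 ≤ j) :
    ζ - approx N c j ∈ valGe p (rootExp p (N + 1)) ∧
      coeffAt (rootExp p (N + 1)) (ζ - approx N c j) ≠ 0 := by
  obtain ⟨ζ₀, hζ₀, hc₀⟩ := exists_isPrimitiveRoot h3 (N + 1) hc
  have h0 := (sub_approx_leading h3 hζ₀ hc₀ j).1
  have hlt : rootExp p (N + 1) < stepExp p N j := by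
    rw [← stepExp_one]
    exact stepExp_strictMono N (by omega)
  obtain ⟨hi, -, hpi, -⟩ := leading_of_isPrimitiveRoot h3 (N := N + 1) hζ
  obtain ⟨hi₀, -, hpi₀, -⟩ := leading_of_isPrimitiveRoot h3 (N := N + 1) hζ₀
  have he := rootExp_pos p (N + 1)
  have hlt1 := rootExp_lt_one p h3 (N + 1)
  have heq : ζ - approx N c j = (ζ - 1 - (ζ₀ - 1)) + (ζ₀ - approx N c j) := by ring
  have h1 := sub_mem hpi hpi₀
  refine ⟨?_, ?_⟩
  · rw [heq]
    exact add_mem h1 (valGe_mono hlt.le h0)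
  · rw [heq, coeffAt_add h1 (valGe_mono hlt.le h0) (by linarith), h0 _ hlt, add_zero,
      sub_sub_sub_cancel_right, coeffAt_sub hi hi₀ (by linarith), hc₀]
    exact sub_ne_zero.2 hne

/-- The passes of the Newton algorithm along the partial sums of the expansion. -/
theorem newton_step_approx (hc : c ^ (p - 1) = -1) (j : ℕ) :
    ((cyclotomic (p ^ (N + 2)) (MalcevNeumann p)).comp (X + C (approx N c j))).coeff 0 ≠ 0 ∧
    maxSlope ((cyclotomic (p ^ (N + 2)) (MalcevNeumann p)).comp (X + C (approx N c j)))
      = stepExp p N j ∧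
    (residuePoly ((cyclotomic (p ^ (N + 2)) (MalcevNeumann p)).comp
      (X + C (approx N c j)))).IsRoot (stepCoeff c j) ∧
    (j ≠ 1 → ∀ a, (residuePoly ((cyclotomic (p ^ (N + 2)) (MalcevNeumann p)).comp
      (X + C (approx N c j)))).IsRoot a → a = stepCoeff c j) := by
  obtain ⟨ζ₀, hζ₀, hc₀⟩ := exists_isPrimitiveRoot h3 (N + 1) hc
  have hp1 : p - 1 ≠ 0 := by omega
  have hpN : 0 < p ^ (N + 2) := pow_pos hp.out.pos _
  have hne : ∀ a : Fpbar p, a ^ (p - 1) = -1 → a ≠ 0 := by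
    rintro a ha rfl
    rw [zero_pow hp1] at ha
    exact neg_ne_zero.2 one_ne_zero ha.symm
  have hprod : (cyclotomic (p ^ (N + 2)) (MalcevNeumann p)).comp (X + C (approx N c j))
      = ∏ μ ∈ primitiveRoots (p ^ (N + 2)) (MalcevNeumann p), (X - C (μ - approx N c j)) := by
    rw [cyclotomic_eq_prod_X_sub_primitiveRoots hζ₀, Polynomial.prod_comp]
    refine Finset.prod_congr rfl fun μ _ => ?_
    rw [sub_comp, X_comp, C_comp, C_sub]
    ring
  have hgood := fun ζ (hζ : IsPrimitiveRoot ζ (p ^ (N + 2)))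
    (h : coeffAt (rootExp p (N + 1)) ζ = c) => sub_approx_leading h3 hζ h j
  have hlead : ∀ μ ∈ primitiveRoots (p ^ (N + 2)) (MalcevNeumann p), ∃ v ≤ stepExp p N j,
      μ - approx N c j ∈ valGe p v ∧ coeffAt v (μ - approx N c j) ≠ 0 ∧
      (v = stepExp p N j → j ≠ 1 → coeffAt v (μ - approx N c j) = stepCoeff c j) := by
    intro μ hμ
    have hμ' := (mem_primitiveRoots hpN).1 hμ
    obtain ⟨hint, hC0, hpi, hCe⟩ := leading_of_isPrimitiveRoot h3 (N := N + 1) hμ'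
    by_cases h : coeffAt (rootExp p (N + 1)) μ = c
    · obtain ⟨h1, h2⟩ := hgood μ hμ' h
      exact ⟨_, le_rfl, h1, by rw [h2]; exact stepCoeff_ne_zero (hne c hc) j, fun _ _ => h2⟩
    · rcases j with _ | _ | j
      · have : μ - approx N c 0 = μ := by simp [approx]
        rw [this, stepExp_zero, stepCoeff_zero]
        exact ⟨0, le_rfl, hint, by rw [hC0]; exact one_ne_zero, fun _ _ => hC0⟩
      · have : approx N c 1 = 1 := by
          rw [approx, Finset.sum_range_one, stepCoeff_zero, stepExp_zero, ppow_zero, map_one,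
            mul_one]
        have he := rootExp_pos p (N + 1)
        have hlt1 := rootExp_lt_one p h3 (N + 1)
        rw [zero_add, this, stepExp_one]
        refine ⟨_, le_rfl, hpi, ?_, fun _ h => absurd rfl h⟩
        rw [coeffAt_sub hint one_mem_valGe (by linarith), coeffAt_one, if_neg he.ne', sub_zero]
        exact hne _ hCe
      · obtain ⟨h1, h2⟩ := sub_approx_leading_of_ne h3 hc hμ' h (j := j + 2) (by omega)
        have hlt : rootExp p (N + 1) < stepExp p N (j + 2) := by
          rw [← stepExp_one]
          exact stepExp_strictMono N (by omega)
        exact ⟨_, hlt.le, h1, h2, fun h => absurd h hlt.ne⟩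
  have hmem₀ := (mem_primitiveRoots hpN).2 hζ₀
  obtain ⟨g1, g2⟩ := hgood ζ₀ hζ₀ hc₀
  rw [hprod]
  obtain ⟨s1, s2, s3⟩ := newton_step (primitiveRoots (p ^ (N + 2)) (MalcevNeumann p))
    (fun μ => μ - approx N c j) (stepExp p N j)
    (fun μ hμ => by obtain ⟨v, h1, h2, h3, -⟩ := hlead μ hμ; exact ⟨v, h1, h2, h3⟩)
    ⟨ζ₀, hmem₀, g1⟩
  refine ⟨s1, s2, (s3 _).2 ⟨ζ₀, hmem₀, g1, g2⟩, fun hj a ha => ?_⟩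
  obtain ⟨μ, hμ, h1, h2⟩ := (s3 a).1 ha
  obtain ⟨v, v1, v2, v3, v4⟩ := hlead μ hμ
  have hv := le_antisymm v1 (le_of_mem_valGe h1 v3)
  rw [← h2, ← hv]
  exact v4 hv hj

theorem isNewtonRun_approx (hc : c ^ (p - 1) = -1) :
    IsNewtonRun (cyclotomic (p ^ (N + 2)) (MalcevNeumann p)) (stepCoeff c) (approx N c) where
  init := by simp [approx]
  root i _ := (newton_step_approx h3 hc i).2.2.1
  step i _ := by
    rw [(newton_step_approx h3 hc i).2.1, approx, Finset.sum_range_succ, approx]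
  halt i h := absurd h (newton_step_approx h3 hc i).1

/-- The constant term never vanishes, so the run does not halt, and every pass but the one with
index `1` offers a single root. -/
theorem IsNewtonRun.eq_approx (hc : c ^ (p - 1) = -1) {a : ℕ → Fpbar p} {r : ℕ → MalcevNeumann p}
    (h : IsNewtonRun (cyclotomic (p ^ (N + 2)) (MalcevNeumann p)) a r) (ha : a 1 = c) (j : ℕ) :
    r j = approx N c j := by
  induction j with
  | zero => rw [h.init]; simp [approx]
  | succ j ih =>
    obtain ⟨s1, s2, -, s4⟩ := newton_step_approx (N := N) h3 hc j
    have haj : a j = stepCoeff c j := by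
      rcases eq_or_ne j 1 with rfl | hj
      · rw [ha, stepCoeff_one]
      · exact s4 hj _ (by rw [← ih]; exact h.root j (by rw [ih]; exact s1))
    rw [h.step j (by rw [ih]; exact s1), ih, s2, haj, approx, approx, Finset.sum_range_succ]

end Run

theorem teich_div {a b : Fpbar p} (hb : b ≠ 0) : teich p (a / b) = teich p a / teich p b := by
  have hb' : teich p b ≠ 0 := by
    intro h
    have := coeffAt_zero_teich b
    rw [h, coeffAt_zero] at this
    exact hb this.symm
  rw [eq_div_iff hb', ← map_mul, div_mul_cancel₀ _ hb]

end MalcevNeumann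

theorem theorem3p2 (p : ℕ) [Fact p.Prime] (hp : 3 ≤ p) (n : ℕ) (hn : 2 ≤ n)
    (z : Fpbar p) (hz : IsPrimitiveRoot z (2 * (p - 1))) :
    (∃ (c : ℕ → Fpbar p) (r : ℕ → MalcevNeumann p),
      MalcevNeumann.IsNewtonRun (Polynomial.cyclotomic (p ^ n) (MalcevNeumann p)) c r ∧
        c 1 = (-1) ^ n * z) ∧
    (∀ (c : ℕ → Fpbar p) (r : ℕ → MalcevNeumann p),
      MalcevNeumann.IsNewtonRun (Polynomial.cyclotomic (p ^ n) (MalcevNeumann p)) c r →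
      c 1 = (-1) ^ n * z →
      (∀ i : ℕ, i ≤ p - 1 →
        r (i + 1) = ∑ k ∈ Finset.range (i + 1),
          (-1) ^ (k * n) / MalcevNeumann.teich p (Nat.factorial k : Fpbar p)
            * MalcevNeumann.teich p z ^ k
            * MalcevNeumann.ppow p ((k : ℚ) / ((p : ℚ) ^ (n - 1) * ((p : ℚ) - 1)))) ∧
      (∀ i : ℕ, p ≤ i →
        r (i + 1) = r p + ∑ l ∈ Finset.Icc n (i - p + n),
          (-1) ^ n * MalcevNeumann.teich p z
            * MalcevNeumann.ppow p (1 / ((p : ℚ) ^ (n - 2) * ((p : ℚ) - 1)) - 1 / (p : ℚ) ^ l))) ∧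
    (∀ ζ : MalcevNeumann p, IsPrimitiveRoot ζ (p ^ n) →
      MalcevNeumann.coeffAt (1 / ((p : ℚ) ^ (n - 1) * ((p : ℚ) - 1))) ζ = (-1) ^ n * z →
      (∀ k : ℕ, k ≤ p - 1 →
        MalcevNeumann.coeffAt ((k : ℚ) / ((p : ℚ) ^ (n - 1) * ((p : ℚ) - 1))) ζ
          = (-1) ^ (k * n) / (Nat.factorial k : Fpbar p) * z ^ k) ∧
      (∀ l : ℕ, n ≤ l →
        MalcevNeumann.coeffAt
            (1 / ((p : ℚ) ^ (n - 2) * ((p : ℚ) - 1)) - 1 / (p : ℚ) ^ l) ζ = (-1) ^ n * z) ∧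
      (∀ x : ℚ, x < 1 / ((p : ℚ) ^ (n - 2) * ((p : ℚ) - 1)) →
        (∀ k : ℕ, k ≤ p - 1 → x ≠ (k : ℚ) / ((p : ℚ) ^ (n - 1) * ((p : ℚ) - 1))) →
        (∀ l : ℕ, n ≤ l →
          x ≠ 1 / ((p : ℚ) ^ (n - 2) * ((p : ℚ) - 1)) - 1 / (p : ℚ) ^ l) →
        MalcevNeumann.coeffAt x ζ = 0)) := by
  open MalcevNeumann in
  obtain ⟨N, rfl⟩ : ∃ N, n = N + 2 := ⟨n - 2, by omega⟩
  have hp' : p.Prime := Fact.out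
  have e1 : 1 / ((p : ℚ) ^ (N + 2 - 1) * ((p : ℚ) - 1)) = rootExp p (N + 1) := rfl
  have e2 : 1 / ((p : ℚ) ^ (N + 2 - 2) * ((p : ℚ) - 1)) = rootExp p N := rfl
  have e3 : ∀ k : ℕ, (k : ℚ) / ((p : ℚ) ^ (N + 2 - 1) * ((p : ℚ) - 1))
      = k * rootExp p (N + 1) := fun k => by rw [← e1, mul_one_div]
  simp only [e1, e2, e3]
  -- A square root of `1` other than `1`, since `z` has order `2(p-1)`. The sign in `c` then
  -- disappears because `p - 1` is even.
  have hzp : z ^ (p - 1) = -1 := by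
    have h1 : z ^ (p - 1) * z ^ (p - 1) = 1 := by rw [← pow_add, ← two_mul, hz.pow_eq_one]
    refine (mul_self_eq_one_iff.1 h1).resolve_left fun h => ?_
    have := Nat.le_of_dvd (by omega) (hz.dvd_of_pow_eq_one _ h)
    omega
  obtain ⟨c, hcdef⟩ : ∃ c, c = (-1) ^ (N + 2) * z := ⟨_, rfl⟩
  have hc : c ^ (p - 1) = -1 := by
    have heven : Even (p - 1) := hp'.even_sub_one (by omega)
    rw [hcdef, mul_pow, hzp, ← pow_mul, (heven.mul_left _).neg_one_pow, one_mul]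
  have hpowc : ∀ k : ℕ, c ^ k / (k.factorial : Fpbar p)
      = (-1) ^ (k * (N + 2)) / (k.factorial : Fpbar p) * z ^ k := fun k => by
    rw [hcdef, mul_pow, ← pow_mul, mul_comm (N + 2) k]
    ring
  have hteich : ∀ k, teich p ((-1) ^ k) = (-1) ^ k := fun k => by
    rw [map_pow, teich_neg_one hp]
  rw [← hcdef]
  refine ⟨⟨_, _, isNewtonRun_approx hp hc, stepCoeff_one c⟩, fun a r hr ha => ⟨?_, ?_⟩,
    fun ζ hζ hcζ => ⟨?_, ?_, ?_⟩⟩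
  · intro i hi
    rw [hr.eq_approx hp hc ha, approx]
    refine Finset.sum_congr rfl fun k hk => ?_
    have hkp : k < p := by have := Finset.mem_range.1 hk; omega
    rw [stepCoeff, stepExp, if_pos hkp, if_pos hkp, teich_div (factorial_ne_zero_of_lt hkp), hcdef,
      mul_pow, ← pow_mul, map_mul, hteich, map_pow, mul_comm (N + 2) k]
    ring
  · intro i hi
    -- Split the partial sum after its first `p` terms; the remaining index `k` corresponds to `l =
    -- k + (N + 2)`.
    have hi' : i + 1 = p + (i + 1 - p) := by omega
    rw [hr.eq_approx hp hc ha, hr.eq_approx hp hc ha, hi', approx, approx, Finset.sum_range_add]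
    congr 1
    have hIcc : Finset.Icc (N + 2) (i - p + (N + 2)) = Finset.Ico (N + 2) (i + 1 - p + (N + 2)) := by
      ext l
      simp only [Finset.mem_Icc, Finset.mem_Ico]
      omega
    rw [hIcc, Finset.sum_Ico_eq_sum_range, Nat.add_sub_cancel]
    refine Finset.sum_congr rfl fun k _ => ?_
    rw [stepCoeff, stepExp, if_neg (by omega), if_neg (by omega), Nat.add_sub_cancel_left,
      add_comm k, hcdef, map_mul, hteich]
  · intro k hk
    have hkp : k < p := by omega
    have h := coeffAt_stepExp hp hζ hcζ k
    rw [stepExp, stepCoeff, if_pos hkp, if_pos hkp] at h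
    rw [h, hpowc]
  · intro l hl
    have h := coeffAt_stepExp hp hζ hcζ (p + (l - (N + 2)))
    rwa [stepExp, stepCoeff, if_neg (by omega), if_neg (by omega), Nat.add_sub_cancel_left,
      Nat.sub_add_cancel hl] at h
  · intro x hx h1 h2
    refine coeffAt_of_ne_stepExp hp hζ hcζ hx fun j => ?_
    rw [stepExp]
    split_ifs with hj
    · exact h1 j (by omega)
    · exact h2 _ (by omega)
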